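/- Let $b(z)=c\prod_{k=1}^{N}\frac{z-a_k}{1-\overline{a_k}z}$ be a finite Blaschke product ($|c|=1$, $|a_k|<1$, $N\ge 0$; the case $N=0$ of a unimodular constant is allowed). Let $\mathrm{A}(\mathbb D)$ be the disc algebra, that is, the continuous functions on $\overline{\mathbb D}$ that are holomorphic in $\mathbb D$, and let $\alpha(f)=f\circ b$, both on $\mathrm{A}(\mathbb D)$ and on $\mathrm{C}(\mathbb T)$. For a unital operator algebra $\mathcal A$ and a unital completely contractive endomorphism $\alpha$ of $\mathcal A$, a covariant representation of $(\mathcal A,\alpha)$ is a pair $(\rho,T)$ on a Hilbert space $\mathcal H$, where $\rho:\mathcal A\to\mathcal B(\mathcal H)$ is a unital completely contractive homomorphism and $T\in\mathcal B(\mathcal H)$ is a contraction with $\rho(a)T=T\rho(\alpha(a))$ for all $a\in\mathcal A$. The semicrossed product $\mathcal A\times_\alpha\mathbb Z^+$ is the completion of the algebra of formal polynomials $\sum_{i=0}^n \mathfrak t^i a_i$ ($a_i\in\mathcal A$, $a\,\mathfrak t=\mathfrak t\,\alpha(a)$) in the norm $\sup_{(\rho,T)}\bigl\|\sum_i T^i\rho(a_i)\bigr\|$,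 the supremum being over all covariant representations; its matrix norms are $\|[x_{ij}]\|=\sup_{(\rho,T)}\|[(\rho\times T)(x_{ij})]\|$, where $\rho\times T$ is the continuous extension of $\sum_i\mathfrak t^ia_i\mapsto\sum_i T^i\rho(a_i)$. Then: 1. $\mathrm{A}(\mathbb D)\times_\alpha\mathbb Z^+$ is canonically completely isometrically isomorphic to a subalgebra of $\mathrm{C}(\mathbb T)\times_\alpha\mathbb Z^+$: there is a unital algebra homomorphism $\Phi:\mathrm{A}(\mathbb D)\times_\alpha\mathbb Z^+\to\mathrm{C}(\mathbb T)\times_\alpha\mathbb Z^+$ with $\Phi(f)=f|_{\mathbb T}$ for $f\in\mathrm{A}(\mathbb D)$ and $\Phi(\mathfrak t)=\mathfrak t$ that is isometric and preserves the norm of every $n\times n$ matrix for every $n$. 2. Whenever $A,T$ are contractions on a Hilbert space $\mathcal H$ with $AT=T\,b(A)$, there are a Hilbert space $\mathcal K\supseteq\mathcal H$, a unitary $U$ and a contraction $S$ on $\mathcal K$ such that $US=S\,b(U)$ and $P_{\mathcal H}S^nU^m|_{\mathcal H}=T^nA^m$ for all $m,n\ge 0$. -/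

import Mathlib

open scoped ComplexOrder

universe u

set_option linter.unusedSectionVars false

noncomputable section

/-! ### Concrete unital operator algebras and completely contractive maps

A unital operator algebra is a unital subalgebra `A` of a unital C⋆-algebra `B`; the matrix norms
on `A` are those of the C⋆-algebras `Mₙ(B)`. -/

section OperatorAlgebra

variable {B : Type u} [CStarAlgebra B] [PartialOrder B] [StarOrderedRing B]

/-- The norm of an `n × n` matrix over the operator algebra `A ⊆ B`, computed in `Mₙ(B)`. -/
def opMatrixNorm (A : Subalgebra ℂ B) {n : ℕ} (M : Matrix (Fin n) (Fin n) A) : ℝ :=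
  ‖CStarMatrix.ofMatrix (M.map (fun a => (a : B)))‖

/-- The norm of an `n × n` matrix of bounded operators on `H`, i.e. its norm in `Mₙ(B(H))`. -/
def opNormMatrix {H : Type u} [NormedAddCommGroup H] [InnerProductSpace ℂ H] [CompleteSpace H]
    {n : ℕ} (M : Matrix (Fin n) (Fin n) (H →L[ℂ] H)) : ℝ :=
  ‖CStarMatrix.ofMatrix M‖

/-- A covariant representation of `(A, α)`: a completely contractive unital representation `ρ` of
`A` on a Hilbert space `H` and a contraction `T` on `H` such that `ρ(a) T = T ρ(α(a))`.
(The Hilbert spaces are taken in the universe of `B`. This loses nothing: the norm of a matrix over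
the image of `ρ × T` is the supremum of the norms of its restrictions to closed invariant subspaces
generated by finitely many vectors, and these are spaces of density character at most that
of `A`, or countable.) -/
structure CovariantRep {A : Subalgebra ℂ B} (α : A →ₐ[ℂ] A) where
  H : Type u
  [normedAddCommGroup : NormedAddCommGroup H]
  [innerProductSpace : InnerProductSpace ℂ H]
  [completeSpace : CompleteSpace H]
  ρ : A →ₐ[ℂ] (H →L[ℂ] H)
  completelyContractive : ∀ (n : ℕ) (M : Matrix (Fin n) (Fin n) A),
    opNormMatrix (M.map ρ) ≤ opMatrixNorm A M
  T : H →L[ℂ] H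
  norm_T_le : ‖T‖ ≤ 1
  covariant : ∀ a : A, ρ a * T = T * ρ (α a)

attribute [instance] CovariantRep.normedAddCommGroup CovariantRep.innerProductSpace
  CovariantRep.completeSpace

/-- The space of formal polynomials `∑ tⁱ aᵢ` with coefficients `aᵢ ∈ A` (written on the right of
the powers of the variable); the coefficient function is `i ↦ aᵢ`. -/
def CovariantPoly {A : Subalgebra ℂ B} (_α : A →ₐ[ℂ] A) : Type u := ℕ →₀ A

namespace CovariantPoly

variable {A : Subalgebra ℂ B} {α : A →ₐ[ℂ] A}

instance : AddCommGroup (CovariantPoly α) := inferInstanceAs (AddCommGroup (ℕ →₀ A))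
instance : Module ℂ (CovariantPoly α) := inferInstanceAs (Module ℂ (ℕ →₀ A))

/-- The monomial `tⁱ a`. -/
def monomial (α : A →ₐ[ℂ] A) (i : ℕ) : A →ₗ[ℂ] CovariantPoly α := Finsupp.lsingle i

theorem induction_poly {P : CovariantPoly α → Prop} (p : CovariantPoly α) (h0 : P 0)
    (hadd : ∀ p q, P p → P q → P (p + q)) (hm : ∀ i a, P (monomial α i a)) : P p :=
  Finsupp.induction_linear p h0 hadd hm

/-- Linear extension of a map given on monomials. -/
def lift {E : Type*} [AddCommGroup E] [Module ℂ E] (f : ℕ → A →ₗ[ℂ] E) :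
    CovariantPoly α →ₗ[ℂ] E := Finsupp.lsum ℂ f

@[simp] theorem lift_monomial {E : Type*} [AddCommGroup E] [Module ℂ E] (f : ℕ → A →ₗ[ℂ] E)
    (i : ℕ) (a : A) : lift f (monomial α i a) = f i a :=
  Finsupp.sum_single_index (map_zero (f i))

/-- The multiplication determined by `a t = t α(a)`, as a bilinear map. -/
def mulBilin : CovariantPoly α →ₗ[ℂ] CovariantPoly α →ₗ[ℂ] CovariantPoly α :=
  lift fun i => LinearMap.flip (lift fun j =>
    LinearMap.flip (((LinearMap.mul ℂ A).compr₂ (monomial α (i + j))) ∘ₗ (α ^ j).toLinearMap))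

instance : Mul (CovariantPoly α) := ⟨fun p q => mulBilin p q⟩
instance : One (CovariantPoly α) := ⟨monomial α 0 1⟩

theorem mul_def (p q : CovariantPoly α) : p * q = mulBilin p q := rfl
theorem one_def : (1 : CovariantPoly α) = monomial α 0 1 := rfl

/-- `(tⁱ a) (tʲ c) = tⁱ⁺ʲ αʲ(a) c`. -/
theorem monomial_mul_monomial (i j : ℕ) (a c : A) :
    monomial α i a * monomial α j c = monomial α (i + j) ((α ^ j) a * c) := by
  simp [mul_def, mulBilin]

theorem add_mul' (p q r : CovariantPoly α) : (p + q) * r = p * r + q * r := by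
  simp [mul_def]

theorem mul_add' (p q r : CovariantPoly α) : p * (q + r) = p * q + p * r := by
  simp [mul_def]

theorem zero_mul' (p : CovariantPoly α) : 0 * p = 0 := by
  simp [mul_def]

theorem mul_zero' (p : CovariantPoly α) : p * 0 = 0 := by
  simp [mul_def]

instance : Ring (CovariantPoly α) where
  __ := (inferInstance : AddCommGroup (CovariantPoly α))
  left_distrib := mul_add'
  right_distrib := add_mul'
  zero_mul := zero_mul'
  mul_zero := mul_zero'
  one_mul p := by
    induction p using induction_poly with
    | h0 => exact mul_zero' _
    | hadd p q hp hq => rw [mul_add', hp, hq]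
    | hm i a => rw [one_def, monomial_mul_monomial]; simp
  mul_one p := by
    induction p using induction_poly with
    | h0 => exact zero_mul' _
    | hadd p q hp hq => rw [add_mul', hp, hq]
    | hm i a => rw [one_def, monomial_mul_monomial]; simp
  mul_assoc p q r := by
    induction p using induction_poly with
    | h0 => simp only [zero_mul']
    | hadd p p' hp hp' => simp only [add_mul', hp, hp']
    | hm i a =>
      induction q using induction_poly with
      | h0 => simp only [zero_mul', mul_zero']
      | hadd q q' hq hq' => simp only [add_mul', mul_add', hq, hq']
      | hm j c =>
        induction r using induction_poly with
        | h0 => simp only [mul_zero']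
        | hadd r r' hr hr' => simp only [mul_add', hr, hr']
        | hm k d =>
          simp only [monomial_mul_monomial, map_mul, add_assoc, mul_assoc]
          rw [add_comm j k, pow_add]
          rfl

instance : Algebra ℂ (CovariantPoly α) :=
  Algebra.ofModule (fun r p q => by simp [mul_def]) (fun r p q => by simp [mul_def])

/-- The representation `∑ tⁱ aᵢ ↦ ∑ Tⁱ ρ(aᵢ)` of the polynomial algebra given by a covariant
representation. -/
def eval (π : CovariantRep α) : CovariantPoly α →ₐ[ℂ] (π.H →L[ℂ] π.H) :=
  AlgHom.ofLinearMap
    (lift fun i => (LinearMap.mulLeft ℂ (π.T ^ i)) ∘ₗ π.ρ.toLinearMap)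
    (by simp [one_def])
    (fun p q => by
      have key : ∀ (j : ℕ) (a : A), π.ρ a * π.T ^ j = π.T ^ j * π.ρ ((α ^ j) a) := by
        intro j
        induction j with
        | zero => intro a; simp
        | succ j ih =>
          intro a
          rw [pow_succ, ← mul_assoc, ih, mul_assoc, π.covariant, ← mul_assoc, pow_succ' α]
          rfl
      induction p using induction_poly with
      | h0 => simp
      | hadd p p' hp hp' => simp only [add_mul, map_add, hp, hp']
      | hm i a =>
        induction q using induction_poly with
        | h0 => simp
        | hadd q q' hq hq' => simp only [mul_add, map_add, hq, hq']
        | hm j c =>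
          rw [monomial_mul_monomial]
          simp only [lift_monomial, LinearMap.comp_apply, AlgHom.toLinearMap_apply,
            LinearMap.mulLeft_apply, map_mul]
          rw [pow_add, mul_assoc, mul_assoc, ← mul_assoc (π.ρ a), key, mul_assoc])

@[simp] theorem eval_monomial (π : CovariantRep α) (i : ℕ) (a : A) :
    eval π (monomial α i a) = π.T ^ i * π.ρ a := by
  simp [eval]

theorem bddAbove_norm_eval (p : CovariantPoly α) :
    BddAbove (Set.range fun π : CovariantRep α => ‖eval π p‖) := by
  induction p using induction_poly with
  | h0 => exact ⟨0, by rintro _ ⟨π, rfl⟩; simp⟩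
  | hadd p q hp hq =>
    obtain ⟨C, hC⟩ := hp
    obtain ⟨D, hD⟩ := hq
    refine ⟨C + D, ?_⟩
    rintro _ ⟨π, rfl⟩
    have h1 : ‖eval π p‖ ≤ C := hC ⟨π, rfl⟩
    have h2 : ‖eval π q‖ ≤ D := hD ⟨π, rfl⟩
    simp only [map_add]
    exact (norm_add_le _ _).trans (add_le_add h1 h2)
  | hm i a =>
    refine ⟨opMatrixNorm A (Matrix.of fun _ _ : Fin 1 => a), ?_⟩
    rintro _ ⟨π, rfl⟩
    simp only [eval_monomial]
    have h1 : ‖π.T ^ i‖ ≤ 1 := by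
      rcases Nat.eq_zero_or_pos i with rfl | hi
      · rw [pow_zero]; exact ContinuousLinearMap.norm_id_le
      · exact (norm_pow_le' π.T hi).trans (pow_le_one₀ (norm_nonneg _) π.norm_T_le)
    have h2 := π.completelyContractive 1 (Matrix.of fun _ _ : Fin 1 => a)
    have h3 : ‖π.ρ a‖ ≤ opNormMatrix ((Matrix.of fun _ _ : Fin 1 => a).map π.ρ) :=
      CStarMatrix.norm_entry_le_norm (i := 0) (j := 0)
        (M := CStarMatrix.ofMatrix ((Matrix.of fun _ _ : Fin 1 => a).map π.ρ))
    calc ‖π.T ^ i * π.ρ a‖ ≤ ‖π.T ^ i‖ * ‖π.ρ a‖ := norm_mul_le _ _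
      _ ≤ 1 * ‖π.ρ a‖ := by gcongr
      _ ≤ _ := by rw [one_mul]; exact h3.trans h2

/-- `‖p‖ = sup ‖∑ Tⁱ ρ(aᵢ)‖` over all covariant representations `(ρ, T)`. -/
instance : Norm (CovariantPoly α) := ⟨fun p => ⨆ π : CovariantRep α, ‖eval π p‖⟩

theorem norm_def (p : CovariantPoly α) : ‖p‖ = ⨆ π : CovariantRep α, ‖eval π p‖ := rfl

theorem norm_eval_le (π : CovariantRep α) (p : CovariantPoly α) : ‖eval π p‖ ≤ ‖p‖ :=
  le_ciSup (bddAbove_norm_eval p) π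

theorem norm_nonneg' (p : CovariantPoly α) : 0 ≤ ‖p‖ :=
  Real.iSup_nonneg fun _ => norm_nonneg _

instance : SeminormedAddCommGroup (CovariantPoly α) :=
  AddGroupSeminorm.toSeminormedAddCommGroup
    { toFun := fun p => ‖p‖
      map_zero' := by simp [norm_def]
      add_le' := fun p q => Real.iSup_le
        (fun π => by
          rw [map_add]
          exact (norm_add_le _ _).trans (add_le_add (norm_eval_le π p) (norm_eval_le π q)))
        (add_nonneg (norm_nonneg' p) (norm_nonneg' q))
      neg' := fun p => by simp [norm_def] }

instance : SeminormedRing (CovariantPoly α) where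
  __ := (inferInstance : SeminormedAddCommGroup (CovariantPoly α))
  __ := (inferInstance : Ring (CovariantPoly α))
  norm_mul_le p q := Real.iSup_le
    (fun π => by
      rw [map_mul]
      exact (norm_mul_le _ _).trans
        (mul_le_mul (norm_eval_le π p) (norm_eval_le π q) (norm_nonneg _) (norm_nonneg' p)))
    (mul_nonneg (norm_nonneg' p) (norm_nonneg' q))

instance : NormedAlgebra ℂ (CovariantPoly α) where
  norm_smul_le r p := Real.iSup_le
    (fun π => by
      rw [map_smul, norm_smul]
      exact mul_le_mul_of_nonneg_left (norm_eval_le π p) (norm_nonneg r))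
    (mul_nonneg (norm_nonneg r) (norm_nonneg' p))

theorem continuous_eval (π : CovariantRep α) : Continuous (eval π) :=
  AddMonoidHomClass.continuous_of_bound (eval π) 1 fun p => by
    rw [one_mul]; exact norm_eval_le π p

end CovariantPoly

/-- The semicrossed product `A ×_α ℤ⁺`: the completion of the polynomial algebra. It is a complex
Banach algebra. -/
def SemicrossedProduct {A : Subalgebra ℂ B} (α : A →ₐ[ℂ] A) : Type u :=
  UniformSpace.Completion (CovariantPoly α)

namespace SemicrossedProduct

variable {A : Subalgebra ℂ B} {α : A →ₐ[ℂ] A}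

instance : NormedRing (SemicrossedProduct α) :=
  inferInstanceAs (NormedRing (UniformSpace.Completion (CovariantPoly α)))

instance : Algebra ℂ (SemicrossedProduct α) :=
  inferInstanceAs (Algebra ℂ (UniformSpace.Completion (CovariantPoly α)))

instance : CompleteSpace (SemicrossedProduct α) :=
  inferInstanceAs (CompleteSpace (UniformSpace.Completion (CovariantPoly α)))

/-- The canonical homomorphism of the polynomial algebra into its completion. -/
def ofPoly (α : A →ₐ[ℂ] A) : CovariantPoly α →ₐ[ℂ] SemicrossedProduct α where
  __ := (UniformSpace.Completion.coeRingHom :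
    CovariantPoly α →+* UniformSpace.Completion (CovariantPoly α))
  commutes' _ := rfl

theorem denseRange_ofPoly : DenseRange (ofPoly α) :=
  UniformSpace.Completion.denseRange_coe

theorem norm_ofPoly (p : CovariantPoly α) : ‖ofPoly α p‖ = ‖p‖ :=
  UniformSpace.Completion.norm_coe p

instance : NormedAlgebra ℂ (SemicrossedProduct α) where
  norm_smul_le r x := by
    induction x using denseRange_ofPoly.induction_on with
    | hp => exact isClosed_le (by simp only [Algebra.smul_def]; fun_prop) (by fun_prop)
    | ih p =>
      rw [← map_smul, norm_ofPoly, norm_ofPoly]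
      exact norm_smul_le r p

/-- The canonical image in `A ×_α ℤ⁺` of an element of `A`. -/
def coeff (α : A →ₐ[ℂ] A) (a : A) : SemicrossedProduct α :=
  ofPoly α (CovariantPoly.monomial α 0 a)

/-- The generator `t` of `A ×_α ℤ⁺`. -/
def gen (α : A →ₐ[ℂ] A) : SemicrossedProduct α :=
  ofPoly α (CovariantPoly.monomial α 1 1)

/-- The representation `ρ × T` of `A ×_α ℤ⁺` given by a covariant representation `(ρ, T)`: the
continuous extension of `∑ tⁱ aᵢ ↦ ∑ Tⁱ ρ(aᵢ)`. -/
def integrated (π : CovariantRep α) : SemicrossedProduct α →+* (π.H →L[ℂ] π.H) :=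
  UniformSpace.Completion.extensionHom (CovariantPoly.eval π).toRingHom
    (CovariantPoly.continuous_eval π)

theorem integrated_ofPoly (π : CovariantRep α) (p : CovariantPoly α) :
    integrated π (ofPoly α p) = CovariantPoly.eval π p :=
  UniformSpace.Completion.extensionHom_coe _ (CovariantPoly.continuous_eval π) p

theorem continuous_integrated (π : CovariantRep α) : Continuous (integrated π) :=
  UniformSpace.Completion.continuous_extension

theorem norm_integrated_le (π : CovariantRep α) (x : SemicrossedProduct α) :
    ‖integrated π x‖ ≤ ‖x‖ := by
  induction x using denseRange_ofPoly.induction_on with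
  | hp =>
    have := continuous_integrated π
    exact isClosed_le (by fun_prop) (by fun_prop)
  | ih p =>
    rw [integrated_ofPoly, norm_ofPoly]
    exact CovariantPoly.norm_eval_le π p

/-- The matrix norms of the operator algebra `A ×_α ℤ⁺`: the supremum of the norms of
`[(ρ × T)(xᵢⱼ)]` over all covariant representations `(ρ, T)`. -/
def matrixNorm {n : ℕ} (M : Matrix (Fin n) (Fin n) (SemicrossedProduct α)) : ℝ :=
  ⨆ π : CovariantRep α, opNormMatrix (M.map (integrated π))

theorem bddAbove_opNormMatrix {n : ℕ} (M : Matrix (Fin n) (Fin n) (SemicrossedProduct α)) :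
    BddAbove (Set.range fun π : CovariantRep α => opNormMatrix (M.map (integrated π))) := by
  refine ⟨∑ j, ∑ i, ‖M i j‖, ?_⟩
  rintro _ ⟨π, rfl⟩
  have h : ∀ N : CStarMatrix (Fin n) (Fin n) (π.H →L[ℂ] π.H), ‖N‖ ≤ ∑ j, ∑ i, ‖N i j‖ := by
    intro N
    rw [CStarMatrix.norm_def]
    refine (CStarMatrix.toCLM N).opNorm_le_bound (by positivity) fun v => ?_
    simp only [CStarMatrix.toCLM_apply_eq_sum, Finset.sum_mul]
    apply WithCStarModule.pi_norm_le_sum_norm _ |>.trans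
    gcongr with i _
    change ‖∑ k, v k * N k i‖ ≤ _
    apply norm_sum_le _ _ |>.trans
    gcongr with j _
    apply norm_mul_le _ _ |>.trans
    rw [mul_comm]
    gcongr
    exact WithCStarModule.norm_apply_le_norm v j
  refine (h _).trans ?_
  gcongr with j _ i _
  exact norm_integrated_le π (M i j)

end SemicrossedProduct

end OperatorAlgebra

/-! ### Finite Blaschke products -/

/-- A finite Blaschke product `b(z) = c ∏ (z - a) / (1 - ā z)`, with `|c| = 1` and finitely many
zeros `a` in the open unit disc, repeated according to multiplicity. The empty product (a
unimodular constant) is allowed. -/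
structure FiniteBlaschke where
  c : ℂ
  norm_c : ‖c‖ = 1
  zeros : List ℂ
  norm_zeros : ∀ a ∈ zeros, ‖a‖ < 1

namespace FiniteBlaschke

/-- The value `b(z)` at a complex number. -/
def eval (b : FiniteBlaschke) (z : ℂ) : ℂ :=
  b.c * (b.zeros.map fun a => (z - a) / (1 - starRingEnd ℂ a * z)).prod

/-- The value `b(A)` at a bounded operator, `c ∏ (A - a) (1 - ā A)⁻¹`; when `‖A‖ ≤ 1` the
operators `1 - ā A` are invertible and the factors commute. -/
def evalOp (b : FiniteBlaschke) {H : Type*} [NormedAddCommGroup H] [InnerProductSpace ℂ H]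
    (A : H →L[ℂ] H) : H →L[ℂ] H :=
  b.c • (b.zeros.map fun a => (A - a • 1) * Ring.inverse (1 - starRingEnd ℂ a • A)).prod

theorem normSq_sub (a z : ℂ) :
    ‖1 - starRingEnd ℂ a * z‖ ^ 2 - ‖z - a‖ ^ 2 = (1 - ‖a‖ ^ 2) * (1 - ‖z‖ ^ 2) := by
  simp only [← Complex.normSq_eq_norm_sq, Complex.normSq_apply]
  simp
  ring

theorem denom_ne_zero {a z : ℂ} (ha : ‖a‖ < 1) (hz : ‖z‖ ≤ 1) :
    1 - starRingEnd ℂ a * z ≠ 0 := by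
  intro h
  have h1 : ‖starRingEnd ℂ a * z‖ = 1 := by rw [← sub_eq_zero.mp h]; simp
  rw [norm_mul, RCLike.norm_conj] at h1
  nlinarith [norm_nonneg a, norm_nonneg z]

theorem norm_factor_le {a z : ℂ} (ha : ‖a‖ < 1) (hz : ‖z‖ ≤ 1) :
    ‖(z - a) / (1 - starRingEnd ℂ a * z)‖ ≤ 1 := by
  have hd := norm_pos_iff.mpr (denom_ne_zero ha hz)
  rw [norm_div, div_le_one hd]
  have := normSq_sub a z
  have h1 : 0 ≤ (1 - ‖a‖ ^ 2) * (1 - ‖z‖ ^ 2) :=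
    mul_nonneg (by nlinarith [norm_nonneg a]) (by nlinarith [norm_nonneg z])
  exact le_of_sq_le_sq (by linarith) hd.le
where
  le_of_sq_le_sq {x y : ℝ} (h : x ^ 2 ≤ y ^ 2) (hy : 0 ≤ y) : x ≤ y := by
    nlinarith [abs_le_of_sq_le_sq h hy, le_abs_self x]

theorem norm_factor_lt {a z : ℂ} (ha : ‖a‖ < 1) (hz : ‖z‖ < 1) :
    ‖(z - a) / (1 - starRingEnd ℂ a * z)‖ < 1 := by
  have hd := norm_pos_iff.mpr (denom_ne_zero ha hz.le)
  rw [norm_div, div_lt_one hd]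
  have := normSq_sub a z
  have h1 : 0 < (1 - ‖a‖ ^ 2) * (1 - ‖z‖ ^ 2) :=
    mul_pos (by nlinarith [norm_nonneg a]) (by nlinarith [norm_nonneg z])
  exact lt_of_pow_lt_pow_left₀ 2 hd.le (by linarith)

theorem norm_factor_eq {a z : ℂ} (ha : ‖a‖ < 1) (hz : ‖z‖ = 1) :
    ‖(z - a) / (1 - starRingEnd ℂ a * z)‖ = 1 := by
  have hd := norm_pos_iff.mpr (denom_ne_zero ha hz.le)
  rw [norm_div, div_eq_one_iff_eq hd.ne']
  have := normSq_sub a z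
  rw [hz] at this
  exact (pow_left_inj₀ (norm_nonneg _) hd.le two_ne_zero).mp (by linarith)

theorem norm_prod_le (l : List ℂ) (hl : ∀ a ∈ l, ‖a‖ < 1) {z : ℂ} (hz : ‖z‖ ≤ 1) :
    ‖(l.map fun a => (z - a) / (1 - starRingEnd ℂ a * z)).prod‖ ≤ 1 := by
  induction l with
  | nil => simp
  | cons a l ih =>
    simp only [List.map_cons, List.prod_cons, norm_mul]
    exact mul_le_one₀ (norm_factor_le (hl a (by simp)) hz) (norm_nonneg _)
      (ih fun x hx => hl x (by simp [hx]))

theorem norm_eval_le (b : FiniteBlaschke) {z : ℂ} (hz : ‖z‖ ≤ 1) : ‖b.eval z‖ ≤ 1 := by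
  rw [eval, norm_mul, b.norm_c, one_mul]
  exact norm_prod_le _ b.norm_zeros hz

theorem norm_eval_eq (b : FiniteBlaschke) {z : ℂ} (hz : ‖z‖ = 1) : ‖b.eval z‖ = 1 := by
  rw [eval, norm_mul, b.norm_c, one_mul]
  have : ∀ l : List ℂ, (∀ a ∈ l, ‖a‖ < 1) →
      ‖(l.map fun a => (z - a) / (1 - starRingEnd ℂ a * z)).prod‖ = 1 := by
    intro l
    induction l with
    | nil => simp
    | cons a l ih =>
      intro hl
      simp only [List.map_cons, List.prod_cons, norm_mul]
      rw [norm_factor_eq (hl a (by simp)) hz, ih fun x hx => hl x (by simp [hx]), one_mul]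
  exact this _ b.norm_zeros

theorem norm_eval_lt (b : FiniteBlaschke) (hb : b.zeros ≠ []) {z : ℂ} (hz : ‖z‖ < 1) :
    ‖b.eval z‖ < 1 := by
  rw [eval, norm_mul, b.norm_c, one_mul]
  have h := b.norm_zeros
  cases hl : b.zeros with
  | nil => exact absurd hl hb
  | cons a l =>
    rw [hl] at h
    simp only [List.map_cons, List.prod_cons, norm_mul]
    exact mul_lt_one_of_nonneg_of_lt_one_left (norm_nonneg _)
      (norm_factor_lt (h a (by simp)) hz) (norm_prod_le l (fun x hx => h x (by simp [hx])) hz.le)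

theorem differentiableOn_eval (b : FiniteBlaschke) :
    ∀ z, ‖z‖ ≤ 1 → DifferentiableAt ℂ b.eval z := by
  intro z hz
  have : ∀ l : List ℂ, (∀ a ∈ l, ‖a‖ < 1) → DifferentiableAt ℂ
      (fun z => (l.map fun a => (z - a) / (1 - starRingEnd ℂ a * z)).prod) z := by
    intro l
    induction l with
    | nil => simp
    | cons a l ih =>
      intro hl
      simp only [List.map_cons, List.prod_cons]
      refine DifferentiableAt.mul (DifferentiableAt.div (by fun_prop) (by fun_prop)
        (denom_ne_zero (hl a (by simp)) hz)) (ih fun x hx => hl x (by simp [hx]))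
  exact (this _ b.norm_zeros).const_mul b.c

/-- `b` as a self-map of the closed unit disc. -/
def diskMap (b : FiniteBlaschke) :
    C(Metric.closedBall (0 : ℂ) 1, Metric.closedBall (0 : ℂ) 1) where
  toFun z := ⟨b.eval z, by
    have := z.2
    rw [mem_closedBall_zero_iff] at this ⊢
    exact b.norm_eval_le this⟩
  continuous_toFun := by
    refine Continuous.subtype_mk ?_ _
    rw [continuous_iff_continuousAt]
    intro z
    exact ContinuousAt.comp (g := b.eval)
      (b.differentiableOn_eval z (mem_closedBall_zero_iff.mp z.2)).continuousAt
      continuous_subtype_val.continuousAt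

/-- `b` as a self-map of the unit circle. -/
def circleMap (b : FiniteBlaschke) : C(Circle, Circle) where
  toFun z := ⟨b.eval z, mem_sphere_zero_iff_norm.mpr (b.norm_eval_eq z.norm_coe)⟩
  continuous_toFun := by
    refine Continuous.subtype_mk ?_ _
    rw [continuous_iff_continuousAt]
    intro z
    exact ContinuousAt.comp (g := b.eval)
      (b.differentiableOn_eval z z.norm_coe.le).continuousAt
      continuous_subtype_val.continuousAt

end FiniteBlaschke

/-! ### The disc algebra and the algebra of continuous functions on the circle -/

/-- The disc algebra: continuous functions on the closed unit disc that are holomorphic in the open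
unit disc, inside the C⋆-algebra of all continuous functions on the closed disc. -/
def diskAlgebra : Subalgebra ℂ C(Metric.closedBall (0 : ℂ) 1, ℂ) where
  carrier := {f | ∃ g : ℂ → ℂ, DifferentiableOn ℂ g (Metric.ball 0 1) ∧
    ∀ z : Metric.closedBall (0 : ℂ) 1, f z = g z}
  mul_mem' := by
    rintro f f' ⟨g, hg, h⟩ ⟨g', hg', h'⟩
    exact ⟨fun z => g z * g' z, hg.mul hg', fun z => by simp [h, h']⟩
  add_mem' := by
    rintro f f' ⟨g, hg, h⟩ ⟨g', hg', h'⟩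
    exact ⟨fun z => g z + g' z, hg.add hg', fun z => by simp [h, h']⟩
  algebraMap_mem' r := ⟨fun _ => r, differentiableOn_const r, fun z => by simp⟩

/-- The algebra `C(𝕋)`. -/
def circleAlgebra : Subalgebra ℂ C(Circle, ℂ) := ⊤

/-- The endomorphism `α(f) = f ∘ b` of the disc algebra. -/
def diskEndo (b : FiniteBlaschke) : diskAlgebra →ₐ[ℂ] diskAlgebra :=
  ((ContinuousMap.compRightAlgHom ℂ ℂ b.diskMap).comp diskAlgebra.val).codRestrict diskAlgebra (by
    rintro ⟨f, g, hg, h⟩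
    by_cases hb : b.zeros = []
    · refine ⟨fun _ => g b.c, differentiableOn_const _, fun z => ?_⟩
      change f (b.diskMap z) = _
      rw [h]
      simp [FiniteBlaschke.diskMap, FiniteBlaschke.eval, hb]
    · refine ⟨fun z => g (b.eval z), ?_, fun z => h (b.diskMap z)⟩
      refine hg.comp (fun z hz => ?_) (fun z hz => ?_)
      · exact (b.differentiableOn_eval z
          (mem_ball_zero_iff.mp hz).le).differentiableWithinAt
      · exact mem_ball_zero_iff.mpr (b.norm_eval_lt hb (mem_ball_zero_iff.mp hz)))

/-- The endomorphism `α(f) = f ∘ b` of `C(𝕋)`. -/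
def circleEndo (b : FiniteBlaschke) : circleAlgebra →ₐ[ℂ] circleAlgebra :=
  ((ContinuousMap.compRightAlgHom ℂ ℂ b.circleMap).comp circleAlgebra.val).codRestrict
    circleAlgebra (fun _ => Algebra.mem_top)

/-- The inclusion of the unit circle in the closed unit disc. -/
def circleToDisk : C(Circle, Metric.closedBall (0 : ℂ) 1) where
  toFun z := ⟨z, mem_closedBall_zero_iff.mpr z.norm_coe.le⟩
  continuous_toFun := by fun_prop

/-- The restriction homomorphism `f ↦ f|_𝕋` from the disc algebra to `C(𝕋)`. -/
def restrictToCircle : diskAlgebra →ₐ[ℂ] circleAlgebra :=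
  ((ContinuousMap.compRightAlgHom ℂ ℂ circleToDisk).comp diskAlgebra.val).codRestrict
    circleAlgebra (fun _ => Algebra.mem_top)

end

/-! ### Contractions between Hilbert spaces -/

section Contractions

variable {H K L : Type*} [NormedAddCommGroup H] [InnerProductSpace ℂ H] [CompleteSpace H]
  [NormedAddCommGroup K] [InnerProductSpace ℂ K] [CompleteSpace K]
  [NormedAddCommGroup L] [InnerProductSpace ℂ L] [CompleteSpace L]

/-! Everything rests on the dilation of a pair `A T = T b(A)`. Let `V` be the Schäffer isometry on
`ℓ²(H)`; its coordinate projection `P` onto the first entry satisfies `P V = A P`, hence `P b(V) =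
b(A) P`. A finite Blaschke product of an isometry is an isometry, so `W = b(V)` is isometric and `X
= T P` satisfies `A X = X W`. Commutant lifting now gives a contraction `Y` with `V Y = Y W` and `P
Y = X`. Since `W` is already an isometry, the rows of `Y` can be built one at a time:
`exists_next_row` finds each new row by a Douglas factorization through the defect operator of the
rows already found, and the exact norm balance it carries along makes the next factorization
possible.

Next, `V` extends to a unitary `U` (`exists_unitary_extension`), `b(U)` is a unitary extending
`b(V)`, and `Y` extends to a contraction `S` with `U S = S b(U)`, forced to be `b(U)⁻ⁿ k ↦ U⁻ⁿ Y k`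
on the smallest subspace reducing `b(U)` and chosen to be zero on its orthogonal complement
(`exists_intertwining_extension`). Compressing `Sⁿ Uᵐ` to `H` passes through `Yⁿ Vᵐ` and gives `Tⁿ
Aᵐ`.

For the semicrossed products, a covariant representation `(ρ, T)` of the disc system gives `A =
ρ(z)` with `A T = T b(A)`. The functional calculus of the dilating unitary `U` represents `C(𝕋)`,
and `S` is covariant for it. Polynomials are dense in the disc algebra, so `(ρ, T)` is a compression
of the restriction of a circle representation. Conversely every circle representation restricts to a
disc representation. Restriction and compression give the two inequalities between the norms, at
every matrix level. -/

theorem ContinuousLinearMap.norm_apply_le_of_norm_le_one {A : H →L[ℂ] K} (hA : ‖A‖ ≤ 1) (x : H) :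
    ‖A x‖ ≤ ‖x‖ := by
  simpa using A.le_of_opNorm_le hA x

theorem ContinuousLinearMap.norm_le_one_of_norm_apply_le {A : H →L[ℂ] K}
    (hA : ∀ x, ‖A x‖ ≤ ‖x‖) : ‖A‖ ≤ 1 :=
  A.opNorm_le_bound zero_le_one (by simpa using hA)

/-- Every contraction has a defect operator. -/
theorem exists_defect (C : H →L[ℂ] K) (hC : ∀ x, ‖C x‖ ≤ ‖x‖) :
    ∃ D : H →L[ℂ] H, ∀ x, ‖D x‖ ^ 2 = ‖x‖ ^ 2 - ‖C x‖ ^ 2 := by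
  have hpos : 0 ≤ 1 - (ContinuousLinearMap.adjoint C) ∘L C := by
    rw [ContinuousLinearMap.nonneg_iff_isPositive, ContinuousLinearMap.isPositive_iff_complex]
    intro x
    have h : inner ℂ ((1 - (ContinuousLinearMap.adjoint C) ∘L C) x) x
        = ((‖x‖ ^ 2 - ‖C x‖ ^ 2 : ℝ) : ℂ) := by
      simp [ContinuousLinearMap.adjoint_inner_left, inner_self_eq_norm_sq_to_K]
    rw [h]
    simp only [RCLike.re_to_complex, Complex.ofReal_re, true_and]
    have := hC x
    nlinarith [norm_nonneg (C x)]
  refine ⟨CFC.sqrt (1 - (ContinuousLinearMap.adjoint C) ∘L C), fun x => ?_⟩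
  set D := CFC.sqrt (1 - (ContinuousLinearMap.adjoint C) ∘L C) with hD
  have hD2 : D * D = 1 - (ContinuousLinearMap.adjoint C) ∘L C := CFC.sqrt_mul_sqrt_self _ hpos
  have hDs : IsSelfAdjoint D := IsSelfAdjoint.of_nonneg (CFC.sqrt_nonneg _)
  have hDa : ContinuousLinearMap.adjoint D = D := hDs
  have h1 : inner ℂ (D x) (D x) = inner ℂ ((D * D) x) x := by
    have := ContinuousLinearMap.adjoint_inner_left D x (D x)
    rw [hDa] at this
    exact this.symm
  rw [hD2] at h1
  simp only [sub_apply, inner_sub_left, ContinuousLinearMap.comp_apply,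
    ContinuousLinearMap.adjoint_inner_left, one_apply_eq_self,
    inner_self_eq_norm_sq_to_K] at h1
  exact_mod_cast h1

/-- A linear map dominated by `e` factors through `e` by a contraction. -/
theorem exists_contraction_factor {E : Type*} [AddCommGroup E] [Module ℂ E] (e : E →ₗ[ℂ] K)
    (f : E →ₗ[ℂ] H) (h : ∀ x, ‖f x‖ ≤ ‖e x‖) :
    ∃ G : K →L[ℂ] H, (∀ x, ‖G x‖ ≤ ‖x‖) ∧ (∀ x, G (e x) = f x) ∧
      ∀ y ∈ (LinearMap.range e)ᗮ, G y = 0 := by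
  set M := (LinearMap.range e).topologicalClosure with hM
  have hmem : ∀ x, e x ∈ M := fun x => Submodule.le_topologicalClosure _ ⟨x, rfl⟩
  let e' : E →ₗ[ℂ] M := e.codRestrict M hmem
  have hdense : DenseRange e' := by
    intro y
    rw [Topology.IsInducing.subtypeVal.closure_eq_preimage_closure_image]
    have : (Subtype.val '' Set.range e' : Set K) = (LinearMap.range e : Set K) := by
      ext z
      constructor
      · rintro ⟨_, ⟨x, rfl⟩, rfl⟩
        exact ⟨x, rfl⟩
      · rintro ⟨x, rfl⟩
        exact ⟨e' x, ⟨x, rfl⟩, rfl⟩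
    rw [Set.mem_preimage]
    refine (closure_mono this.ge) ?_
    exact y.2
  have hnorm : ∀ x, ‖f x‖ ≤ 1 * ‖e' x‖ := fun x => by rw [one_mul]; exact h x
  have : CompleteSpace M := (Submodule.isClosed_topologicalClosure _).completeSpace_coe
  -- The factor is extended by continuity to the closure `M` of the range and by zero on the
  -- orthogonal complement.
  refine ⟨(f.extendOfNorm e') ∘L M.orthogonalProjectionOnto, fun x => ?_, fun x => ?_, fun y hy => ?_⟩
  · rw [ContinuousLinearMap.comp_apply]
    have h1 : ‖f.extendOfNorm e'‖ ≤ 1 :=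
      LinearMap.opNorm_extendOfNorm_le hdense zero_le_one hnorm
    refine (ContinuousLinearMap.norm_apply_le_of_norm_le_one h1 _).trans ?_
    exact ContinuousLinearMap.norm_apply_le_of_norm_le_one M.orthogonalProjectionOnto_norm_le x
  · rw [ContinuousLinearMap.comp_apply]
    have h1 : M.orthogonalProjectionOnto (e x) = e' x :=
      Submodule.orthogonalProjectionOnto_mem_subspace_eq_self (e' x)
    rw [h1, LinearMap.extendOfNorm_eq hdense ⟨1, hnorm⟩]
  · rw [ContinuousLinearMap.comp_apply]
    have h1 : M.orthogonalProjectionOnto y = 0 := by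
      rw [Submodule.orthogonalProjectionOnto_eq_zero_iff, hM, Submodule.orthogonal_closure]
      exact hy
    rw [h1, map_zero]

theorem exists_contraction_comp_eq (F : K →L[ℂ] L) (Y : K →L[ℂ] H) (h : ∀ x, ‖Y x‖ ≤ ‖F x‖) :
    ∃ C : L →L[ℂ] H, (∀ x, ‖C x‖ ≤ ‖x‖) ∧ ∀ x, C (F x) = Y x := by
  obtain ⟨C, h1, h2, -⟩ := exists_contraction_factor F.toLinearMap Y.toLinearMap h
  exact ⟨C, h1, h2⟩

/-- The inductive step of commutant lifting: the pair `(R, Y)` consists of the defect operator of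
the rows found so far, and the last row. -/
theorem exists_next_row (W R : K →L[ℂ] K) (Y : K →L[ℂ] H)
    (h : ∀ k, ‖R (W k)‖ ^ 2 = ‖R k‖ ^ 2 + ‖Y k‖ ^ 2) :
    ∃ (R' : K →L[ℂ] K) (Y' : K →L[ℂ] H), (∀ k, ‖R' (W k)‖ ^ 2 = ‖R' k‖ ^ 2 + ‖Y' k‖ ^ 2) ∧
      (∀ k, Y' (W k) = Y k) ∧ ∀ k, ‖R k‖ ^ 2 = ‖R' k‖ ^ 2 + ‖Y' k‖ ^ 2 := by
  -- The balance `h` gives `‖Y k‖ ≤ ‖R W k‖`, so `Y = C R W` with `C` a contraction. The new row is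
  -- `C R`, and the defect `D` of `C` turns `R` into the new remainder `D R`.
  obtain ⟨C, hC, hCF⟩ := exists_contraction_comp_eq (R ∘L W) Y fun x => by
    have := h x
    refine (sq_le_sq₀ (norm_nonneg _) (norm_nonneg _)).mp ?_
    rw [ContinuousLinearMap.comp_apply, this]
    exact le_add_of_nonneg_left (sq_nonneg _)
  obtain ⟨D, hD⟩ := exists_defect C hC
  refine ⟨D ∘L R, C ∘L R, fun k => ?_, fun k => hCF k, fun k => ?_⟩
  · have h1 : C (R (W k)) = Y k := hCF k
    simp only [ContinuousLinearMap.comp_apply, hD, h1]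
    linarith [h k]
  · simp only [ContinuousLinearMap.comp_apply, hD]
    ring

/-- The rows of a commutant lifting. Here `W` is an isometry, `X` a contraction with `A X = X W` and
`D` a defect operator of `A`. -/
theorem exists_lifting_rows (A D : H →L[ℂ] H) (hD : ∀ x, ‖D x‖ ^ 2 = ‖x‖ ^ 2 - ‖A x‖ ^ 2)
    (W : K →L[ℂ] K) (hW : ∀ k, ‖W k‖ = ‖k‖) (X : K →L[ℂ] H) (hX : ∀ k, ‖X k‖ ≤ ‖k‖)
    (hAX : ∀ k, A (X k) = X (W k)) :
    ∃ Z : ℕ → K →L[ℂ] H, Z 0 = X ∧ (∀ k, Z 1 (W k) = D (X k)) ∧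
      (∀ n k, Z (n + 2) (W k) = Z (n + 1) k) ∧
      ∀ k N, ∑ n ∈ Finset.range N, ‖Z n k‖ ^ 2 ≤ ‖k‖ ^ 2 := by
  obtain ⟨R₀, hR₀⟩ := exists_defect X hX
  let State := {p : (K →L[ℂ] K) × (K →L[ℂ] H) //
    ∀ k, ‖p.1 (W k)‖ ^ 2 = ‖p.1 k‖ ^ 2 + ‖p.2 k‖ ^ 2}
  have step : ∀ s : State, ∃ s' : State, (∀ k, s'.1.2 (W k) = s.1.2 k) ∧
      ∀ k, ‖s.1.1 k‖ ^ 2 = ‖s'.1.1 k‖ ^ 2 + ‖s'.1.2 k‖ ^ 2 := by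
    rintro ⟨⟨R, Y⟩, h⟩
    obtain ⟨R', Y', h1, h2, h3⟩ := exists_next_row W R Y h
    exact ⟨⟨⟨R', Y'⟩, h1⟩, h2, h3⟩
  choose next hn1 hn2 using step
  -- The second entry `D X` is not a row of the lifting: it is only the prescribed value of `Z 1` on
  -- the range of `W`. The initial balance holds because `W` is isometric and `A X = X W`: both
  -- sides equal `‖k‖² - ‖A X k‖²`.
  let s₀ : State := ⟨⟨R₀, D ∘L X⟩, fun k => by
    simp only [hR₀, hW, ContinuousLinearMap.comp_apply, hD, hAX]
    ring⟩
  let s : ℕ → State := fun n => next^[n] s₀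
  have hs : ∀ n, s (n + 1) = next (s n) := fun n => Function.iterate_succ_apply' next n s₀
  refine ⟨fun n => Nat.casesOn n X fun m => (s (m + 1)).1.2, rfl, fun k => ?_, fun n k => ?_,
    fun k N => ?_⟩
  · exact hn1 s₀ k
  · change (s (n + 2)).1.2 (W k) = (s (n + 1)).1.2 k
    rw [hs (n + 1)]
    exact hn1 _ k
  · rcases N with _ | N
    · simp
    -- The remainders telescope: what the first rows leave of `‖k‖² - ‖X k‖²` is exactly the squared
    -- norm of the current remainder at `k`.
    have key : ∀ N : ℕ, ∑ n ∈ Finset.range N, ‖(s (n + 1)).1.2 k‖ ^ 2 + ‖(s N).1.1 k‖ ^ 2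
        = ‖k‖ ^ 2 - ‖X k‖ ^ 2 := by
      intro N
      induction N with
      | zero => simpa using! hR₀ k
      | succ N ih =>
        rw [Finset.sum_range_succ, ← ih, hn2 (s N) k, ← hs]
        ring
    rw [Finset.sum_range_succ']
    have := key N
    change ∑ n ∈ Finset.range N, ‖(s (n + 1)).1.2 k‖ ^ 2 + ‖X k‖ ^ 2 ≤ _
    nlinarith [sq_nonneg ‖(s N).1.1 k‖]

/-! ### Operators into spaces of square summable sequences -/

/-- A bounded sequence of rows defines a contraction into the space of square summable
sequences. -/
theorem exists_ofRows (Z : ℕ → K →L[ℂ] H)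
    (hZ : ∀ k N, ∑ n ∈ Finset.range N, ‖Z n k‖ ^ 2 ≤ ‖k‖ ^ 2) :
    ∃ Y : K →L[ℂ] lp (fun _ : ℕ => H) 2, (∀ k n, Y k n = Z n k) ∧ ∀ k, ‖Y k‖ ≤ ‖k‖ := by
  have hsum : ∀ k, Summable fun n => ‖Z n k‖ ^ 2 := fun k =>
    summable_of_sum_range_le (fun n => sq_nonneg _) (hZ k)
  have hmem : ∀ k, Memℓp (fun n => Z n k) 2 := fun k => by
    rw [memℓp_gen_iff (by norm_num)]
    simpa using hsum k
  let Y₀ : K →ₗ[ℂ] lp (fun _ : ℕ => H) 2 :=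
    { toFun := fun k => ⟨fun n => Z n k, hmem k⟩
      map_add' := fun x y => by ext n; exact map_add (Z n) x y
      map_smul' := fun c x => by ext n; exact map_smul (Z n) c x }
  have hb : ∀ k, ‖Y₀ k‖ ≤ 1 * ‖k‖ := fun k => by
    rw [one_mul]
    refine (sq_le_sq₀ (norm_nonneg _) (norm_nonneg _)).mp ?_
    have := lp.norm_rpow_eq_tsum (p := 2) (by norm_num) (Y₀ k)
    simp only [ENNReal.toReal_ofNat, Real.rpow_ofNat] at this
    rw [this]
    exact (hsum k).tsum_le_of_sum_range_le (hZ k)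
  exact ⟨Y₀.mkContinuous 1 hb, fun k n => rfl, fun k => by simpa using hb k⟩

theorem lp.hasSum_norm_sq (x : lp (fun _ : ℕ => H) 2) :
    HasSum (fun n => ‖x n‖ ^ 2) (‖x‖ ^ 2) := by
  simpa using lp.hasSum_norm (p := 2) (by norm_num) x

theorem lp.sum_range_norm_sq_le (x : lp (fun _ : ℕ => H) 2) (N : ℕ) :
    ∑ n ∈ Finset.range N, ‖x n‖ ^ 2 ≤ ‖x‖ ^ 2 :=
  sum_le_hasSum _ (fun _ _ => sq_nonneg _) (lp.hasSum_norm_sq x)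

theorem lp.norm_sq_eq_head_add_tail {L : Type*} [NormedAddCommGroup L] [InnerProductSpace ℂ L]
    (x : lp (fun _ : ℕ => H) 2) (y : lp (fun _ : ℕ => L) 2) (h : ∀ n, ‖y n‖ = ‖x (n + 1)‖) :
    ‖x‖ ^ 2 = ‖x 0‖ ^ 2 + ‖y‖ ^ 2 := by
  have h1 := (lp.hasSum_norm_sq x)
  have h2 : HasSum (fun n => ‖y n‖ ^ 2) (‖y‖ ^ 2) := by
    simpa using lp.hasSum_norm (p := 2) (by norm_num) y
  simp only [h] at h2
  rw [hasSum_nat_add_iff (f := fun n => ‖x n‖ ^ 2) 1] at h2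
  rw [h1.unique h2]
  simp [add_comm]

/-- The left shift on square summable sequences. -/
theorem exists_leftShift (H : Type*) [NormedAddCommGroup H] [InnerProductSpace ℂ H]
    [CompleteSpace H] : ∃ Y : lp (fun _ : ℕ => H) 2 →L[ℂ] lp (fun _ : ℕ => H) 2,
      ∀ k n, Y k n = k (n + 1) := by
  obtain ⟨Y, hY, -⟩ := exists_ofRows (fun n => lp.evalCLM ℂ (fun _ : ℕ => H) 2 (n + 1))
    fun k N => by
      refine le_trans ?_ (lp.sum_range_norm_sq_le k (N + 1))
      rw [Finset.sum_range_succ']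
      exact le_add_of_nonneg_right (sq_nonneg _)
  exact ⟨Y, hY⟩

/-- The Schäffer isometry. -/
theorem exists_schaeffer (A D : H →L[ℂ] H) (hD : ∀ x, ‖D x‖ ^ 2 = ‖x‖ ^ 2 - ‖A x‖ ^ 2) :
    ∃ V : lp (fun _ : ℕ => H) 2 →L[ℂ] lp (fun _ : ℕ => H) 2, (∀ x, ‖V x‖ = ‖x‖) ∧
      (∀ x, V x 0 = A (x 0)) ∧ (∀ x, V x 1 = D (x 0)) ∧ ∀ x n, V x (n + 2) = x (n + 1) := by
  let ev := fun n => lp.evalCLM ℂ (fun _ : ℕ => H) 2 n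
  let Z : ℕ → lp (fun _ : ℕ => H) 2 →L[ℂ] H := fun n =>
    Nat.casesOn n (A ∘L ev 0) fun m => Nat.casesOn m (D ∘L ev 0) fun l => ev (l + 1)
  have hZ0 : ∀ x, Z 0 x = A (x 0) := fun x => rfl
  have hZ1 : ∀ x, Z 1 x = D (x 0) := fun x => rfl
  have hZ2 : ∀ n x, Z (n + 2) x = x (n + 1) := fun n x => rfl
  -- The two entries `A x₀` and `D x₀` together have the squared norm of `x₀`, and the later entries
  -- are moved one place; hence `N + 2` entries of the image match `N + 1` entries of `x`.
  have hs : ∀ x N, ∑ n ∈ Finset.range (N + 2), ‖Z n x‖ ^ 2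
      = ∑ n ∈ Finset.range (N + 1), ‖x n‖ ^ 2 := fun x N => by
    rw [Finset.sum_range_succ', Finset.sum_range_succ', Finset.sum_range_succ']
    simp only [hZ2, zero_add, hZ0, hZ1, hD]
    ring
  have hZ : ∀ x N, ∑ n ∈ Finset.range N, ‖Z n x‖ ^ 2 ≤ ‖x‖ ^ 2 := fun x N => by
    refine le_trans (Finset.sum_le_sum_of_subset_of_nonneg
      (Finset.range_subset_range.mpr (Nat.le_add_right N 2)) fun _ _ _ => sq_nonneg _) ?_
    rw [hs]
    exact lp.sum_range_norm_sq_le x _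
  obtain ⟨V, hV, hVn⟩ := exists_ofRows Z hZ
  refine ⟨V, fun x => ?_, fun x => (hV x 0).trans (hZ0 x), fun x => (hV x 1).trans (hZ1 x),
    fun x n => (hV x _).trans (hZ2 n x)⟩
  refine (sq_eq_sq₀ (norm_nonneg _) (norm_nonneg _)).mp ?_
  have h1 := (lp.hasSum_norm_sq (V x)).tendsto_sum_nat.comp (Filter.tendsto_add_atTop_nat 2)
  have h2 := (lp.hasSum_norm_sq x).tendsto_sum_nat.comp (Filter.tendsto_add_atTop_nat 1)
  refine tendsto_nhds_unique h1 (h2.congr fun N => ?_)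
  simp only [Function.comp_apply, hV, hs]

end Contractions

/-! ### Unitary extension of isometries and of intertwining relations -/

section Unitary

variable {K : Type u} [NormedAddCommGroup K] [InnerProductSpace ℂ K] [CompleteSpace K]

theorem ContinuousLinearMap.mem_unitary_of_norm_map_of_surjective {U : K →L[ℂ] K}
    (hn : ∀ x, ‖U x‖ = ‖x‖) (hs : Function.Surjective U) : U ∈ unitary (K →L[ℂ] K) := by
  let e : K ≃ₗᵢ[ℂ] K := LinearIsometryEquiv.ofSurjective ⟨U.toLinearMap, hn⟩ hs
  have : (Unitary.linearIsometryEquiv.symm e : K →L[ℂ] K) = U := by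
    rw [Unitary.coe_symm_linearIsometryEquiv_apply]
    rfl
  rw [← this]
  exact (Unitary.linearIsometryEquiv.symm e).2

/-- Every isometry extends to a unitary. -/
theorem exists_unitary_extension (V : K →L[ℂ] K) (hV : ∀ x, ‖V x‖ = ‖x‖) :
    ∃ (K' : Type u) (_ : NormedAddCommGroup K') (_ : InnerProductSpace ℂ K')
      (_ : CompleteSpace K') (J : K →ₗᵢ[ℂ] K') (U : K' →L[ℂ] K'),
      U ∈ unitary (K' →L[ℂ] K') ∧ ∀ x, U (J x) = J (V x) := by
  -- `E` is the orthogonal complement of the range of `V`. On `K ⊕ ℓ²(E)` the left shift drops its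
  -- first entry into `E`, filling exactly the part of `K` that `V` misses.
  let E : Submodule ℂ K := (ContinuousLinearMap.adjoint V).ker
  have hEc : CompleteSpace E := (ContinuousLinearMap.isClosed_ker _).completeSpace_coe
  have hE : ∀ d : E, ContinuousLinearMap.adjoint V d = 0 := fun d => d.2
  have hVV : ∀ x, ContinuousLinearMap.adjoint V (V x) = x := fun x =>
    DFunLike.congr_fun ((ContinuousLinearMap.norm_map_iff_adjoint_comp_self V).mp hV) x
  obtain ⟨Sh, hSh⟩ := exists_leftShift E
  let U₀ : WithLp 2 (K × lp (fun _ : ℕ => E) 2) →ₗ[ℂ] WithLp 2 (K × lp (fun _ : ℕ => E) 2) :=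
    { toFun := fun x => WithLp.toLp 2 (V x.fst + (x.snd 0 : K), Sh x.snd)
      map_add' := fun x y => by
        refine WithLp.ofLp_injective 2 (Prod.ext ?_ ?_)
        · simp
          abel
        · simp
      map_smul' := fun c x => by
        refine WithLp.ofLp_injective 2 (Prod.ext ?_ ?_)
        · simp
        · simp }
  have hU₁ : ∀ x, (U₀ x).fst = V x.fst + (x.snd 0 : K) := fun x => rfl
  have hU₂ : ∀ x, (U₀ x).snd = Sh x.snd := fun x => rfl
  have hn : ∀ x, ‖U₀ x‖ = ‖x‖ := fun x => by
    refine (sq_eq_sq₀ (norm_nonneg _) (norm_nonneg _)).mp ?_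
    rw [WithLp.prod_norm_sq_eq_of_L2, WithLp.prod_norm_sq_eq_of_L2, hU₁, hU₂,
      lp.norm_sq_eq_head_add_tail x.snd (Sh x.snd) fun n => by rw [hSh]]
    have h1 : inner ℂ (V x.fst) (x.snd 0 : K) = 0 := by
      rw [← ContinuousLinearMap.adjoint_inner_right, hE, inner_zero_right]
    have h2 := norm_add_sq_eq_norm_sq_add_norm_sq_of_inner_eq_zero (𝕜 := ℂ) _ _ h1
    have h3 : ‖V x.fst + (x.snd 0 : K)‖ ^ 2 = ‖x.fst‖ ^ 2 + ‖x.snd 0‖ ^ 2 := by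
      rw [sq, h2, hV, Submodule.coe_norm]
      ring
    rw [h3]
    ring
  have hs : Function.Surjective U₀ := fun y => by
    -- The component of `y.fst` orthogonal to the range of `V`; the preimage carries it as entry
    -- zero, in front of the right-shifted sequence.
    let d₀ : E := ⟨y.fst - V (ContinuousLinearMap.adjoint V y.fst), by
      change ContinuousLinearMap.adjoint V _ = 0
      rw [map_sub, hVV, sub_self]⟩
    have hmem : Memℓp (fun n => Nat.casesOn n d₀ fun m => y.snd m : ℕ → E) 2 := by
      rw [memℓp_gen_iff (by norm_num)]
      simp only [ENNReal.toReal_ofNat, Real.rpow_ofNat]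
      rw [← summable_nat_add_iff 1]
      exact (lp.hasSum_norm_sq y.snd).summable
    refine ⟨WithLp.toLp 2 (ContinuousLinearMap.adjoint V y.fst, ⟨_, hmem⟩), ?_⟩
    refine WithLp.ofLp_injective 2 (Prod.ext ?_ ?_)
    · exact add_sub_cancel (V (ContinuousLinearMap.adjoint V y.fst)) y.fst
    · refine lp.ext (funext fun n => ?_)
      exact hSh _ n
  let J₀ : K →ₗ[ℂ] WithLp 2 (K × lp (fun _ : ℕ => E) 2) :=
    { toFun := fun x => WithLp.toLp 2 (x, 0)
      map_add' := fun x y => WithLp.ofLp_injective 2 (by simp)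
      map_smul' := fun c x => WithLp.ofLp_injective 2 (by simp) }
  let J : K →ₗᵢ[ℂ] WithLp 2 (K × lp (fun _ : ℕ => E) 2) := ⟨J₀, fun x => by
    refine (sq_eq_sq₀ (norm_nonneg _) (norm_nonneg _)).mp ?_
    rw [WithLp.prod_norm_sq_eq_of_L2]
    simp [J₀]⟩
  refine ⟨WithLp 2 (K × lp (fun _ : ℕ => E) 2), inferInstance, inferInstance, inferInstance, J,
    U₀.mkContinuous 1 fun x => by rw [hn, one_mul],
    ContinuousLinearMap.mem_unitary_of_norm_map_of_surjective hn hs, fun x => ?_⟩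
  refine WithLp.ofLp_injective 2 (Prod.ext ?_ ?_)
  · change V x + ((0 : E) : K) = V x
    simp
  · exact map_zero Sh

variable {K' : Type u} [NormedAddCommGroup K'] [InnerProductSpace ℂ K'] [CompleteSpace K']

theorem ContinuousLinearMap.apply_star_apply_of_mem_unitary {U : K →L[ℂ] K}
    (hU : U ∈ unitary (K →L[ℂ] K)) (x : K) : U (star U x) = x :=
  DFunLike.congr_fun (Unitary.mul_star_self_of_mem hU) x

/-- An operator intertwining the restrictions of two unitaries to an invariant subspace extends to
an operator of no greater norm that intertwines the unitaries. -/
theorem exists_intertwining_extension (J : K →ₗᵢ[ℂ] K') {U B : K' →L[ℂ] K'}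
    (hU : U ∈ unitary (K' →L[ℂ] K')) (hB : B ∈ unitary (K' →L[ℂ] K')) {V W S : K →L[ℂ] K}
    (hS : ∀ x, ‖S x‖ ≤ ‖x‖) (hUJ : ∀ x, U (J x) = J (V x)) (hBJ : ∀ x, B (J x) = J (W x))
    (hVS : ∀ x, V (S x) = S (W x)) :
    ∃ S' : K' →L[ℂ] K', (∀ x, ‖S' x‖ ≤ ‖x‖) ∧ (∀ x, S' (J x) = J (S x)) ∧
      ∀ x, U (S' x) = S' (B x) := by
  -- `R` is the graph of the forced map `B⁻ⁿ J k ↦ U⁻ⁿ J S k`. Asking for all large `n` lets two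
  -- pairs be compared at a common exponent; by `hR` a single exponent is enough.
  let R : K' → K' → Prop := fun x y => ∃ N, ∀ n ≥ N, ∃ k, (B ^ n) x = J k ∧ (U ^ n) y = J (S k)
  have hBn : ∀ n, B ^ n ∈ unitary (K' →L[ℂ] K') := fun n => pow_mem hB n
  have hUn : ∀ n, U ^ n ∈ unitary (K' →L[ℂ] K') := fun n => pow_mem hU n
  have hR : ∀ {x y n k}, (B ^ n) x = J k → (U ^ n) y = J (S k) → R x y := by
    intro x y n k h1 h2
    refine ⟨n, fun m hm => ?_⟩
    induction m, hm using Nat.le_induction with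
    | base => exact ⟨k, h1, h2⟩
    | succ m _ ih =>
      obtain ⟨k, h1, h2⟩ := ih
      refine ⟨W k, ?_, ?_⟩
      · rw [pow_succ', mul_apply_eq_comp, h1, hBJ]
      · rw [pow_succ', mul_apply_eq_comp, h2, hUJ, hVS]
  have hRadd : ∀ {x y x' y'}, R x y → R x' y' → R (x + x') (y + y') := by
    rintro x y x' y' ⟨N, h⟩ ⟨N', h'⟩
    obtain ⟨k, h1, h2⟩ := h (max N N') (le_max_left _ _)
    obtain ⟨k', h1', h2'⟩ := h' (max N N') (le_max_right _ _)
    exact hR (k := k + k') (n := max N N') (by simp only [map_add, h1, h1'])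
      (by simp only [map_add, h2, h2'])
  have hRsmul : ∀ {x y} (c : ℂ), R x y → R (c • x) (c • y) := by
    rintro x y c ⟨N, h⟩
    obtain ⟨k, h1, h2⟩ := h N le_rfl
    exact hR (k := c • k) (n := N) (by simp only [map_smul, h1]) (by simp only [map_smul, h2])
  have hRnorm : ∀ {x y}, R x y → ‖y‖ ≤ ‖x‖ := by
    rintro x y ⟨N, h⟩
    obtain ⟨k, h1, h2⟩ := h N le_rfl
    rw [← ContinuousLinearMap.norm_map_of_mem_unitary (hUn N) y, h2, J.norm_map,
      ← ContinuousLinearMap.norm_map_of_mem_unitary (hBn N) x, h1, J.norm_map]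
    exact hS k
  have hRuniq : ∀ {x y y'}, R x y → R x y' → y = y' := by
    intro x y y' h h'
    have h1 := hRnorm (hRadd h (hRsmul (-1) h'))
    simpa [sub_eq_zero, ← sub_eq_add_neg] using h1
  have hRJ : ∀ k, R (J k) (J (S k)) := fun k => hR (n := 0) rfl rfl
  have hRB : ∀ {x y}, R x y → R (B x) (U y) := by
    rintro x y ⟨N, h⟩
    obtain ⟨k, h1, h2⟩ := h N le_rfl
    refine hR (k := W k) (n := N) ?_ ?_
    · rw [← mul_apply_eq_comp, ← pow_succ, pow_succ', mul_apply_eq_comp,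
        h1, hBJ]
    · rw [← mul_apply_eq_comp, ← pow_succ, pow_succ', mul_apply_eq_comp,
        h2, hUJ, hVS]
  -- Invariance of the domain under `star B` makes its orthogonal complement invariant under `B`.
  have hRB' : ∀ {x y}, R x y → R (star B x) (star U y) := by
    rintro x y ⟨N, h⟩
    obtain ⟨k, h1, h2⟩ := h N le_rfl
    refine hR (k := k) (n := N + 1) ?_ ?_
    · rw [pow_succ, mul_apply_eq_comp,
        ContinuousLinearMap.apply_star_apply_of_mem_unitary hB, h1]
    · rw [pow_succ, mul_apply_eq_comp,
        ContinuousLinearMap.apply_star_apply_of_mem_unitary hU, h2]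
  let M : Submodule ℂ K' :=
    { carrier := {x | ∃ y, R x y}
      zero_mem' := ⟨0, hR (n := 0) (k := 0) (by simp) (by simp)⟩
      add_mem' := by
        rintro x x' ⟨y, h⟩ ⟨y', h'⟩
        exact ⟨_, hRadd h h'⟩
      smul_mem' := by
        rintro c x ⟨y, h⟩
        exact ⟨_, hRsmul c h⟩ }
  choose f hf using fun x : M => x.2
  let F : M →ₗ[ℂ] K' :=
    { toFun := f
      map_add' := fun x x' => hRuniq (hf _) (hRadd (hf x) (hf x'))
      map_smul' := fun c x => hRuniq (hf _) (hRsmul c (hf x)) }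
  obtain ⟨S', hS', hS'F, hS'0⟩ := exists_contraction_factor M.subtype F fun x => hRnorm (hf x)
  have hRS' : ∀ {x y}, R x y → S' x = y := fun {x y} h =>
    (hS'F ⟨x, y, h⟩).trans (hRuniq (hf ⟨x, y, h⟩) h)
  rw [Submodule.range_subtype] at hS'0
  refine ⟨S', hS', fun x => hRS' (hRJ x), ?_⟩
  -- The domain `M` is invariant under `B`, where the relation is built into `R`. On the complement
  -- of its closure, also invariant under `B`, both sides vanish.
  have hker : (⊤ : Submodule ℂ K') ≤ (U * S' - S' * B).ker := by
    have hclosed : IsClosed ((U * S' - S' * B).ker : Set K') :=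
      ContinuousLinearMap.isClosed_ker _
    have h1 : M.topologicalClosure ≤ (U * S' - S' * B).ker := by
      refine Submodule.topologicalClosure_minimal _ ?_ hclosed
      rintro x ⟨y, h⟩
      change U (S' x) - S' (B x) = 0
      rw [hRS' h, hRS' (hRB h), sub_self]
    have h2 : M.topologicalClosureᗮ ≤ (U * S' - S' * B).ker := by
      rw [Submodule.orthogonal_closure]
      intro x hx
      change U (S' x) - S' (B x) = 0
      rw [hS'0 x hx, map_zero, zero_sub, neg_eq_zero]
      refine hS'0 _ ?_
      rw [Submodule.mem_orthogonal] at hx ⊢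
      rintro u ⟨y, h⟩
      rw [← ContinuousLinearMap.adjoint_inner_left]
      exact hx _ ⟨_, hRB' h⟩
    have : CompleteSpace M.topologicalClosure :=
      (Submodule.isClosed_topologicalClosure _).completeSpace_coe
    rw [← Submodule.sup_orthogonal_of_hasOrthogonalProjection (K := M.topologicalClosure)]
    exact sup_le h1 h2
  exact fun x => sub_eq_zero.mp (hker (Submodule.mem_top (x := x)))

end Unitary

/-! ### Blaschke products of operators and the dilation of the pair -/

namespace FiniteBlaschke

variable {H K : Type*} [NormedAddCommGroup H] [InnerProductSpace ℂ H] [CompleteSpace H]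
  [NormedAddCommGroup K] [InnerProductSpace ℂ K] [CompleteSpace K]

theorem isUnit_denom {a : ℂ} (ha : ‖a‖ < 1) {A : H →L[ℂ] H} (hA : ‖A‖ ≤ 1) :
    IsUnit (1 - starRingEnd ℂ a • A) := by
  refine isUnit_one_sub_of_norm_lt_one ?_
  rw [norm_smul, RCLike.norm_conj]
  nlinarith [norm_nonneg a, norm_nonneg A]

/-- An intertwiner of two contractions also intertwines their resolvents, factor by factor. It
serves both the coordinate projection from the coextension and the inclusion in the unitary
extension. -/
theorem evalOp_intertwine (b : FiniteBlaschke) {A : H →L[ℂ] H} {V : K →L[ℂ] K} (hA : ‖A‖ ≤ 1)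
    (hV : ‖V‖ ≤ 1) (X : K →L[ℂ] H) (h : ∀ x, A (X x) = X (V x)) (x : K) :
    b.evalOp A (X x) = X (b.evalOp V x) := by
  have key : ∀ l : List ℂ, (∀ a ∈ l, ‖a‖ < 1) → ∀ x,
      (l.map fun a => (A - a • 1) * Ring.inverse (1 - starRingEnd ℂ a • A)).prod (X x) =
      X ((l.map fun a => (V - a • 1) * Ring.inverse (1 - starRingEnd ℂ a • V)).prod x) := by
    intro l
    induction l with
    | nil => simp
    | cons a l ih =>
      intro hl x
      have hinv : ∀ y, Ring.inverse (1 - starRingEnd ℂ a • A) (X y)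
          = X (Ring.inverse (1 - starRingEnd ℂ a • V) y) := fun y => by
        have hA' := isUnit_denom (hl a (by simp)) hA
        have hV' := isUnit_denom (hl a (by simp)) hV
        have h1 : (1 - starRingEnd ℂ a • A) (X (Ring.inverse (1 - starRingEnd ℂ a • V) y))
            = X y := by
          have h2 : (1 - starRingEnd ℂ a • V) (Ring.inverse (1 - starRingEnd ℂ a • V) y) = y :=
            DFunLike.congr_fun (Ring.mul_inverse_cancel _ hV') y
          conv_rhs => rw [← h2]
          simp [h]
        rw [← h1]
        exact DFunLike.congr_fun (Ring.inverse_mul_cancel _ hA') _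
      simp only [List.map_cons, List.prod_cons, mul_apply_eq_comp]
      rw [ih (fun x hx => hl x (by simp [hx])), hinv]
      simp [h]
  simp [evalOp, key _ b.norm_zeros]

/-- For isometric `V` the squared norms of `(V - a) x` and `(1 - ā V) x` have the same expansion, so
each Möbius factor is isometric. -/
theorem norm_evalOp_apply (b : FiniteBlaschke) {V : H →L[ℂ] H} (hV : ∀ x, ‖V x‖ = ‖x‖) (x : H) :
    ‖b.evalOp V x‖ = ‖x‖ := by
  have hV1 : ‖V‖ ≤ 1 := ContinuousLinearMap.norm_le_one_of_norm_apply_le fun x => (hV x).le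
  have hnum : ∀ (a : ℂ) (x : H), ‖(V - a • 1) x‖ = ‖(1 - starRingEnd ℂ a • V) x‖ := by
    intro a x
    refine (sq_eq_sq₀ (norm_nonneg _) (norm_nonneg _)).mp ?_
    have h1 : (V - a • 1) x = V x - a • x := by simp
    have h2 : (1 - starRingEnd ℂ a • V) x = x - starRingEnd ℂ a • V x := by simp
    rw [h1, h2, @norm_sub_sq ℂ, @norm_sub_sq ℂ, norm_smul, norm_smul, hV, RCLike.norm_conj,
      inner_smul_right, inner_smul_right, ← inner_conj_symm (V x) x,
      ← RCLike.conj_re (a * _), map_mul, RCLike.conj_conj]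
  have key : ∀ l : List ℂ, (∀ a ∈ l, ‖a‖ < 1) → ∀ x,
      ‖(l.map fun a => (V - a • 1) * Ring.inverse (1 - starRingEnd ℂ a • V)).prod x‖ = ‖x‖ := by
    intro l
    induction l with
    | nil => simp
    | cons a l ih =>
      intro hl x
      simp only [List.map_cons, List.prod_cons, mul_apply_eq_comp]
      rw [hnum, ← mul_apply_eq_comp,
        Ring.mul_inverse_cancel _ (isUnit_denom (hl a (by simp)) hV1),
        one_apply_eq_self, ih fun x hx => hl x (by simp [hx])]
  rw [evalOp, smul_apply, norm_smul, b.norm_c, one_mul, key _ b.norm_zeros]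

/-- Isometry is already known; surjectivity comes from invertibility of every factor, where `U - a =
U (1 - a U*)` handles the numerator. -/
theorem evalOp_mem_unitary {H : Type u} [NormedAddCommGroup H] [InnerProductSpace ℂ H]
    [CompleteSpace H] (b : FiniteBlaschke) {U : H →L[ℂ] H} (hU : U ∈ unitary (H →L[ℂ] H)) :
    b.evalOp U ∈ unitary (H →L[ℂ] H) := by
  have hn := ContinuousLinearMap.norm_map_of_mem_unitary hU
  have hU1 : ‖U‖ ≤ 1 := ContinuousLinearMap.norm_le_one_of_norm_apply_le fun x => (hn x).le
  have hU2 : ‖star U‖ ≤ 1 := by rwa [norm_star]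
  have hunit : IsUnit (b.evalOp U) := by
    refine IsUnit.smul (Units.mk0 b.c fun h => by simpa [h] using b.norm_c) ?_
    have key : ∀ l : List ℂ, (∀ a ∈ l, ‖a‖ < 1) → IsUnit
        (l.map fun a => (U - a • 1) * Ring.inverse (1 - starRingEnd ℂ a • U)).prod := by
      intro l
      induction l with
      | nil => simp
      | cons a l ih =>
        intro hl
        have ha := hl a (by simp)
        have h1 : U - a • 1 = U * (1 - starRingEnd ℂ (starRingEnd ℂ a) • star U) := by
          rw [mul_sub, mul_one, mul_smul_comm, Unitary.mul_star_self_of_mem hU, Complex.conj_conj]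
        simp only [List.map_cons, List.prod_cons]
        refine IsUnit.mul (IsUnit.mul ?_ (isUnit_denom ha hU1).ringInverse)
          (ih fun x hx => hl x (by simp [hx]))
        rw [h1]
        exact (Unitary.toUnits ⟨U, hU⟩).isUnit.mul
          (isUnit_denom (by rwa [RCLike.norm_conj]) hU2)
    exact key _ b.norm_zeros
  refine ContinuousLinearMap.mem_unitary_of_norm_map_of_surjective (b.norm_evalOp_apply hn)
    fun y => ?_
  obtain ⟨u, hu⟩ := hunit
  refine ⟨(↑u⁻¹ : H →L[ℂ] H) y, ?_⟩
  rw [← hu]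
  exact DFunLike.congr_fun u.mul_inv y

/-- The embedding of a Hilbert space in the first coordinate of the space of square summable
sequences. -/
theorem _root_.lp.exists_embedding_zero (H : Type*) [NormedAddCommGroup H] [InnerProductSpace ℂ H] :
    ∃ J : H →ₗᵢ[ℂ] lp (fun _ : ℕ => H) 2, (∀ x, J x 0 = x) ∧
      ∀ x y, inner ℂ (J x) y = inner ℂ x (y 0) := by
  let J₀ : H →ₗ[ℂ] lp (fun _ : ℕ => H) 2 :=
    { toFun := fun x => lp.single 2 0 x
      map_add' := lp.single_add (E := fun _ : ℕ => H) 2 0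
      map_smul' := fun c x => lp.single_smul (E := fun _ : ℕ => H) 2 0 c x }
  exact ⟨⟨J₀, fun x => lp.norm_single (E := fun _ : ℕ => H) (by norm_num) 0 x⟩,
    fun x => lp.single_apply_self (E := fun _ : ℕ => H) 2 0 x,
    fun x y => lp.inner_single_left (G := fun _ : ℕ => H) 0 x y⟩

/-- Coextension of a contraction `A` to an isometry `V` and of a contraction `T` with
`A T = T b(A)` to a contraction `Y` with `V Y = Y b(V)`. -/
theorem exists_isometric_coextension (b : FiniteBlaschke) {H : Type u} [NormedAddCommGroup H]
    [InnerProductSpace ℂ H] [CompleteSpace H] {A T : H →L[ℂ] H} (hA : ‖A‖ ≤ 1) (hT : ‖T‖ ≤ 1)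
    (hAT : A * T = T * b.evalOp A) :
    ∃ V Y : lp (fun _ : ℕ => H) 2 →L[ℂ] lp (fun _ : ℕ => H) 2, (∀ x, ‖V x‖ = ‖x‖) ∧
      (∀ x, ‖Y x‖ ≤ ‖x‖) ∧ (∀ x, V (Y x) = Y (b.evalOp V x)) ∧ (∀ x, V x 0 = A (x 0)) ∧
      ∀ x, Y x 0 = T (x 0) := by
  have hAT' : ∀ x, A (T x) = T (b.evalOp A x) := fun x => DFunLike.congr_fun hAT x
  obtain ⟨D, hD⟩ := exists_defect A (ContinuousLinearMap.norm_apply_le_of_norm_le_one hA)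
  obtain ⟨V, hV, hV0, hV1, hV2⟩ := exists_schaeffer A D hD
  have hVn : ‖V‖ ≤ 1 := ContinuousLinearMap.norm_le_one_of_norm_apply_le fun x => (hV x).le
  let P : lp (fun _ : ℕ => H) 2 →L[ℂ] H := lp.evalCLM ℂ (fun _ : ℕ => H) 2 0
  have hPn : ∀ x, ‖P x‖ ≤ ‖x‖ := fun x => lp.norm_apply_le_norm (by norm_num) x 0
  have hPb : ∀ x, b.evalOp A (P x) = P (b.evalOp V x) :=
    b.evalOp_intertwine hA hVn P fun x => (hV0 x).symm
  have hX : ∀ k, A ((T ∘L P) k) = (T ∘L P) (b.evalOp V k) := fun k => by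
    rw [ContinuousLinearMap.comp_apply, ContinuousLinearMap.comp_apply, ← hPb, hAT']
  obtain ⟨Z, hZ0, hZ1, hZ2, hZ⟩ := exists_lifting_rows A D hD (b.evalOp V)
    (b.norm_evalOp_apply hV) (T ∘L P)
    (fun k => (ContinuousLinearMap.norm_apply_le_of_norm_le_one hT _).trans (hPn k)) hX
  obtain ⟨Y, hYZ, hYn⟩ := exists_ofRows Z hZ
  refine ⟨V, Y, hV, hYn, fun x => ?_, hV0, fun x => ?_⟩
  -- Entry by entry, `V Y = Y b(V)` consists of the relation for `X` and the two row relations of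
  -- the lifting.
  · refine lp.ext (funext fun n => ?_)
    rcases n with _ | _ | n
    · rw [hV0, hYZ, hYZ, hZ0, hX]
    · rw [zero_add, hV1, hYZ, hYZ, hZ1, hZ0]
    · rw [hV2, hYZ, hYZ, hZ2]
  · rw [hYZ, hZ0]
    rfl

theorem _root_.ContinuousLinearMap.pow_apply_intertwine {H K : Type*} [NormedAddCommGroup H]
    [InnerProductSpace ℂ H] [NormedAddCommGroup K] [InnerProductSpace ℂ K] {A : H →L[ℂ] H}
    {V : K →L[ℂ] K} {f : K → H} (h : ∀ x, f (V x) = A (f x)) (n : ℕ) (x : K) :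
    f ((V ^ n) x) = (A ^ n) (f x) := by
  induction n generalizing x with
  | zero => rfl
  | succ n ih => rw [pow_succ, pow_succ, mul_apply_eq_comp, mul_apply_eq_comp, ih, h]

/-- Simultaneous dilation of a contraction `A` to a unitary `U` and of a contraction `T` with
`A T = T b(A)` to a contraction `S` with `U S = S b(U)`. -/
theorem exists_unitary_dilation (b : FiniteBlaschke) {H : Type u} [NormedAddCommGroup H]
    [InnerProductSpace ℂ H] [CompleteSpace H] {A T : H →L[ℂ] H} (hA : ‖A‖ ≤ 1) (hT : ‖T‖ ≤ 1)
    (hAT : A * T = T * b.evalOp A) :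
    ∃ (K : Type u) (_ : NormedAddCommGroup K) (_ : InnerProductSpace ℂ K)
      (_ : CompleteSpace K) (J : H →ₗᵢ[ℂ] K) (U S : K →L[ℂ] K),
      U ∈ unitary (K →L[ℂ] K) ∧ ‖S‖ ≤ 1 ∧ U * S = S * b.evalOp U ∧
      ∀ m n : ℕ,
        (ContinuousLinearMap.adjoint J.toContinuousLinearMap) ∘L (S ^ n * U ^ m) ∘L
          J.toContinuousLinearMap = T ^ n * A ^ m := by
  obtain ⟨V, Y, hV, hYn, hVY, hV0, hY0⟩ := b.exists_isometric_coextension hA hT hAT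
  have hVn : ‖V‖ ≤ 1 := ContinuousLinearMap.norm_le_one_of_norm_apply_le fun x => (hV x).le
  obtain ⟨K, i1, i2, i3, J, U, hU, hUJ⟩ := exists_unitary_extension V hV
  have hUn := ContinuousLinearMap.norm_map_of_mem_unitary hU
  have hU1 : ‖U‖ ≤ 1 := ContinuousLinearMap.norm_le_one_of_norm_apply_le fun x => (hUn x).le
  obtain ⟨S, hSn, hSJ, hUS⟩ := exists_intertwining_extension J hU (b.evalOp_mem_unitary hU) hYn hUJ
    (b.evalOp_intertwine hU1 hVn J.toContinuousLinearMap hUJ) hVY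
  obtain ⟨J₀, hJ₀, hJ₀inner⟩ := lp.exists_embedding_zero H
  refine ⟨K, i1, i2, i3, J.comp J₀, U, S, hU,
    ContinuousLinearMap.norm_le_one_of_norm_apply_le hSn, ContinuousLinearMap.ext hUS,
    fun m n => ?_⟩
  refine ContinuousLinearMap.ext fun x => ext_inner_left ℂ fun y => ?_
  rw [ContinuousLinearMap.comp_apply, ContinuousLinearMap.comp_apply,
    ContinuousLinearMap.adjoint_inner_right, mul_apply_eq_comp, mul_apply_eq_comp]
  -- On the range of `J` the operators `U` and `S` act as `V` and `Y`. Pairing with `J₀ y` reads off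
  -- entry zero, which carries `V` to `A` and `Y` to `T`.
  change inner ℂ (J (J₀ y)) ((S ^ n) ((U ^ m) (J (J₀ x)))) = _
  rw [← ContinuousLinearMap.pow_apply_intertwine (f := J) (fun x => (hUJ x).symm),
    ← ContinuousLinearMap.pow_apply_intertwine (f := J) (fun x => (hSJ x).symm),
    J.inner_map_map, hJ₀inner,
    ContinuousLinearMap.pow_apply_intertwine (f := fun x : lp (fun _ : ℕ => H) 2 => x 0) hY0,
    ContinuousLinearMap.pow_apply_intertwine (f := fun x : lp (fun _ : ℕ => H) 2 => x 0) hV0,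
    hJ₀]

end FiniteBlaschke

noncomputable section

/-- Homomorphisms respect inverses of units. The invertibility hypothesis matters: `Ring.inverse` is
zero at a non-unit, whose image could be a unit. -/
theorem map_prod_moebius {R S : Type*} [Ring R] [Algebra ℂ R] [Ring S] [Algebra ℂ S]
    (φ : R →ₐ[ℂ] S) (Z : R) (l : List ℂ)
    (hl : ∀ a ∈ l, IsUnit (1 - starRingEnd ℂ a • Z)) :
    φ (l.map fun a => (Z - a • 1) * Ring.inverse (1 - starRingEnd ℂ a • Z)).prod =
      (l.map fun a => (φ Z - a • 1) * Ring.inverse (1 - starRingEnd ℂ a • φ Z)).prod := by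
  rw [map_list_prod, List.map_map]
  refine congrArg List.prod (List.map_congr_left fun a ha => ?_)
  obtain ⟨u, hu⟩ := hl a ha
  have h : φ (1 - starRingEnd ℂ a • Z) = 1 - starRingEnd ℂ a • φ Z := by simp
  have h2 : (Units.map (φ : R →* S) u : S) = 1 - starRingEnd ℂ a • φ Z := by
    rw [← h, ← hu]
    rfl
  rw [Function.comp_apply, map_mul, ← hu, ← h2, Ring.inverse_unit, Ring.inverse_unit]
  simp

/-! ### The disc algebra -/

/-- The coordinate function of the disc algebra. -/
def diskCoord : diskAlgebra :=
  ⟨⟨Subtype.val, continuous_subtype_val⟩, id, differentiableOn_id, fun _ => rfl⟩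

/-- Evaluation of the elements of the disc algebra at a point of the closed disc. -/
def diskEval (z : Metric.closedBall (0 : ℂ) 1) : diskAlgebra →ₐ[ℂ] ℂ :=
  (ContinuousMap.evalAlgHom ℂ ℂ z).comp diskAlgebra.val

theorem diskEval_apply (z : Metric.closedBall (0 : ℂ) 1) (f : diskAlgebra) :
    diskEval z f = f.1 z := rfl

theorem diskEval_coord (z : Metric.closedBall (0 : ℂ) 1) : diskEval z diskCoord = z := rfl

theorem diskEval_smul (z : Metric.closedBall (0 : ℂ) 1) (c : ℂ) (f : diskAlgebra) :
    diskEval z (c • f) = c * diskEval z f := rfl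

theorem diskAlgebra_ext {f g : diskAlgebra} (h : ∀ z, diskEval z f = diskEval z g) : f = g :=
  Subtype.ext (ContinuousMap.ext h)

theorem isUnit_one_sub_smul_diskCoord {a : ℂ} (ha : ‖a‖ < 1) :
    IsUnit (1 - starRingEnd ℂ a • diskCoord) := by
  have hne : ∀ z : Metric.closedBall (0 : ℂ) 1, 1 - starRingEnd ℂ a * (z : ℂ) ≠ 0 := fun z =>
    FiniteBlaschke.denom_ne_zero ha (mem_closedBall_zero_iff.mp z.2)
  let g : diskAlgebra := ⟨⟨fun z => (1 - starRingEnd ℂ a * (z : ℂ))⁻¹,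
      Continuous.inv₀ (by fun_prop) hne⟩, fun z => (1 - starRingEnd ℂ a * z)⁻¹,
    DifferentiableOn.inv (by fun_prop) fun z hz =>
      FiniteBlaschke.denom_ne_zero ha (mem_ball_zero_iff.mp hz).le, fun _ => rfl⟩
  refine IsUnit.of_mul_eq_one g (diskAlgebra_ext fun z => ?_)
  rw [map_mul, map_sub, diskEval_smul, map_one, diskEval_coord]
  exact mul_inv_cancel₀ (hne z)

/-- Writing `α(z)` algebraically in `z` within the disc algebra lets any unital homomorphism
evaluate it; covariance at `z` thereby becomes `A T = T b(A)`. -/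
theorem diskEndo_coord (b : FiniteBlaschke) : diskEndo b diskCoord = b.c •
    (b.zeros.map fun a => (diskCoord - a • 1) *
      Ring.inverse (1 - starRingEnd ℂ a • diskCoord)).prod := by
  refine diskAlgebra_ext fun z => ?_
  rw [diskEval_smul, map_prod_moebius (diskEval z) _ _
    fun a ha => isUnit_one_sub_smul_diskCoord (b.norm_zeros a ha)]
  change b.eval z = _
  simp [FiniteBlaschke.eval, diskEval_coord, div_eq_mul_inv]

theorem map_diskEndo_coord (b : FiniteBlaschke) {H : Type*} [NormedAddCommGroup H]
    [InnerProductSpace ℂ H] (ρ : diskAlgebra →ₐ[ℂ] (H →L[ℂ] H)) :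
    ρ (diskEndo b diskCoord) = b.evalOp (ρ diskCoord) := by
  rw [diskEndo_coord, map_smul, map_prod_moebius ρ _ _
    fun a ha => isUnit_one_sub_smul_diskCoord (b.norm_zeros a ha)]
  rfl

/-- The Taylor sums at zero converge uniformly on any ball of radius less than `R`, and one of these
contains the closed unit disc. -/
theorem exists_polynomial_near_of_differentiableOn {h : ℂ → ℂ} {R : NNReal} (hR : 1 < R)
    (hh : DifferentiableOn ℂ h (Metric.closedBall 0 R)) {ε : ℝ} (hε : 0 < ε) :
    ∃ p : Polynomial ℂ, ∀ z : ℂ, ‖z‖ ≤ 1 → ‖h z - p.eval z‖ < ε := by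
  have hps := hh.hasFPowerSeriesOnBall (zero_lt_one.trans hR)
  obtain ⟨r, hr1, hrR⟩ := exists_between hR
  have hu := hps.tendstoUniformlyOn (r' := r) (by exact_mod_cast hrR)
  obtain ⟨n, hn⟩ := (Metric.tendstoUniformlyOn_iff.mp hu ε hε).exists
  refine ⟨∑ k ∈ Finset.range n,
    Polynomial.C ((cauchyPowerSeries h 0 R).coeff k) * Polynomial.X ^ k, fun z hz => ?_⟩
  have hr1' : (1 : ℝ) < r := by exact_mod_cast hr1
  have := hn z (mem_ball_zero_iff.mpr (hz.trans_lt hr1'))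
  rw [dist_eq_norm, zero_add] at this
  convert! this using 3
  rw [Polynomial.eval_finsetSum, FormalMultilinearSeries.partialSum]
  refine Finset.sum_congr rfl fun k _ => ?_
  rw [FormalMultilinearSeries.apply_eq_pow_smul_coeff]
  rw [Polynomial.eval_mul, Polynomial.eval_C, Polynomial.eval_pow, Polynomial.eval_X, smul_eq_mul,
    mul_comm]

/-- Polynomials are dense in the disc algebra. -/
theorem exists_polynomial_near (f : diskAlgebra) {ε : ℝ} (hε : 0 < ε) :
    ∃ p : Polynomial ℂ, ‖f - Polynomial.aeval diskCoord p‖ < ε := by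
  obtain ⟨f, g, hg, hfg⟩ := f
  have huc : UniformContinuous f := CompactSpace.uniformContinuous_of_continuous f.continuous
  obtain ⟨δ, hδ, hδf⟩ := Metric.uniformContinuous_iff.mp huc (ε / 4) (by positivity)
  -- `f` is replaced by its dilate `z ↦ f(r z)`: `1 - r < δ` keeps it uniformly within `ε / 4` of
  -- `f`, while `R < r⁻¹` makes it holomorphic beyond the closed unit disc.
  obtain ⟨r, hr0, hr1⟩ : ∃ r, max 0 (1 - δ) < r ∧ r < 1 :=
    exists_between (max_lt zero_lt_one (by linarith))
  obtain ⟨hr0, hrδ⟩ := max_lt_iff.mp hr0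
  obtain ⟨R, hR1, hRr⟩ : ∃ R : ℝ, 1 < R ∧ R < r⁻¹ := exists_between ((one_lt_inv₀ hr0).mpr hr1)
  lift R to NNReal using by linarith
  have hdiff : DifferentiableOn ℂ (fun z => g (r * z)) (Metric.closedBall 0 R) := by
    refine hg.comp (by fun_prop) fun z hz => ?_
    rw [mem_closedBall_zero_iff] at hz
    rw [mem_ball_zero_iff, norm_mul, Complex.norm_of_nonneg hr0.le]
    calc r * ‖z‖ ≤ r * R := by gcongr
      _ < r * r⁻¹ := by gcongr
      _ = 1 := mul_inv_cancel₀ hr0.ne'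
  obtain ⟨p, hp⟩ := exists_polynomial_near_of_differentiableOn (by exact_mod_cast hR1) hdiff
    (show 0 < ε / 4 by positivity)
  refine ⟨p, lt_of_le_of_lt (b := ε / 2) ?_ (by linarith)⟩
  refine (ContinuousMap.norm_le _ (by positivity)).mpr fun z => ?_
  have hz : ‖(z : ℂ)‖ ≤ 1 := mem_closedBall_zero_iff.mp z.2
  have hmem : (r * z : ℂ) ∈ Metric.closedBall (0 : ℂ) 1 := by
    rw [mem_closedBall_zero_iff, norm_mul, Complex.norm_of_nonneg hr0.le]
    nlinarith [norm_nonneg (z : ℂ)]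
  have h1 : ‖f z - f ⟨r * z, hmem⟩‖ < ε / 4 := by
    rw [← dist_eq_norm]
    refine hδf ?_
    rw [Subtype.dist_eq, dist_eq_norm]
    have : (z : ℂ) - r * z = ((1 - r : ℝ) : ℂ) * z := by push_cast; ring
    rw [this, norm_mul, Complex.norm_of_nonneg (by linarith)]
    nlinarith [norm_nonneg (z : ℂ)]
  have h2 := hp z hz
  rw [hfg ⟨r * z, hmem⟩] at h1
  have h3 : (Polynomial.aeval diskCoord p : diskAlgebra).1 z = p.eval (z : ℂ) := by
    rw [← diskEval_apply, ← Polynomial.aeval_algHom_apply, diskEval_coord, Polynomial.coe_aeval_eq_eval]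
  change ‖f z - (Polynomial.aeval diskCoord p : diskAlgebra).1 z‖ ≤ ε / 2
  rw [h3]
  have := norm_sub_le_norm_sub_add_norm_sub (f z) (g (r * z)) (p.eval (z : ℂ))
  linarith

/-- Continuous linear maps that agree on the powers of the coordinate function agree. -/
theorem diskAlgebra_linearMap_ext {E : Type*} [NormedAddCommGroup E] [NormedSpace ℂ E]
    {F G : diskAlgebra →ₗ[ℂ] E} (hF : Continuous F) (hG : Continuous G)
    (h : ∀ m : ℕ, F (diskCoord ^ m) = G (diskCoord ^ m)) : F = G := by
  have hd : Dense (Set.range fun p : Polynomial ℂ => (Polynomial.aeval diskCoord p : diskAlgebra)) :=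
    Metric.dense_iff.mpr fun f ε hε => by
      obtain ⟨p, hp⟩ := exists_polynomial_near f hε
      exact ⟨_, by rwa [Metric.mem_ball, dist_comm, dist_eq_norm], p, rfl⟩
  refine DFunLike.coe_injective (hF.ext_on hd hG ?_)
  rintro _ ⟨p, rfl⟩
  simp only [Polynomial.aeval_eq_sum_range, map_sum, map_smul, h]

/-! ### Representations of the continuous functions on the circle -/

/-- The coordinate function on the circle. -/
def circleCoord : C(Circle, ℂ) := ⟨Subtype.val, continuous_subtype_val⟩

variable {K : Type*} [NormedAddCommGroup K] [InnerProductSpace ℂ K] [CompleteSpace K]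

/-- The spectrum of a unitary lies on the circle, so functions on the circle restrict to it and the
continuous functional calculus applies. -/
theorem exists_circle_calculus {U : K →L[ℂ] K} (hU : U ∈ unitary (K →L[ℂ] K)) :
    ∃ σ : C(Circle, ℂ) →⋆ₐ[ℂ] (K →L[ℂ] K), σ circleCoord = U := by
  have hn : IsStarNormal U := ⟨by
    rw [commute_iff_eq, Unitary.star_mul_self_of_mem hU, Unitary.mul_star_self_of_mem hU]⟩
  let ι : C(spectrum ℂ U, Circle) :=
    ⟨fun z => ⟨z, spectrum.subset_circle_of_unitary hU z.2⟩,
      Continuous.subtype_mk continuous_subtype_val _⟩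
  exact ⟨(cfcHom hn).comp (ContinuousMap.compStarAlgHom' ℂ ℂ ι), cfcHom_id hn⟩

theorem circle_topologicalClosure_adjoin_coord :
    (StarAlgebra.adjoin ℂ {circleCoord}).topologicalClosure = ⊤ := by
  refine ContinuousMap.starSubalgebra_topologicalClosure_eq_top_of_separatesPoints _ fun x y hxy =>
    ⟨_, ⟨circleCoord, StarAlgebra.subset_adjoin ℂ _ rfl, rfl⟩, fun h => hxy (Subtype.ext h)⟩

/-- The functions satisfying the relation form a closed subalgebra. It contains the conjugate
coordinate because `σ` and `τ` send the coordinate to invertible elements, and the relation passes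
to their inverses. Stone–Weierstrass finishes. -/
theorem circle_covariant {σ τ : C(Circle, ℂ) →⋆ₐ[ℂ] (K →L[ℂ] K)} {S : K →L[ℂ] K}
    (h : σ circleCoord * S = S * τ circleCoord) (f : C(Circle, ℂ)) : σ f * S = S * τ f := by
  let E : Subalgebra ℂ C(Circle, ℂ) :=
    { carrier := {f | σ f * S = S * τ f}
      mul_mem' := fun {f g} hf hg => by
        change σ (f * g) * S = S * τ (f * g)
        rw [map_mul, map_mul, mul_assoc, hg, ← mul_assoc, hf, mul_assoc]
      add_mem' := fun {f g} hf hg => by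
        change σ (f + g) * S = S * τ (f + g)
        rw [map_add, map_add, add_mul, mul_add, hf, hg]
      algebraMap_mem' := fun r => by
        change σ (algebraMap ℂ _ r) * S = S * τ (algebraMap ℂ _ r)
        rw [AlgHomClass.commutes, AlgHomClass.commutes, Algebra.commutes] }
  have hE : ∀ {f}, f ∈ E ↔ σ f * S = S * τ f := Iff.rfl
  have hzz : circleCoord * star circleCoord = 1 := by
    ext z
    exact (Complex.mul_conj' z).trans (by simp [z.norm_coe])
  have hclosed : IsClosed (E : Set C(Circle, ℂ)) := by
    have hσ : Continuous σ := map_continuous σ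
    have hτ : Continuous τ := map_continuous τ
    exact isClosed_eq (by fun_prop) (by fun_prop)
  have hadj : (StarAlgebra.adjoin ℂ {circleCoord}).toSubalgebra ≤ E := by
    rw [StarAlgebra.adjoin_toSubalgebra, Algebra.adjoin_le_iff, Set.union_subset_iff]
    refine ⟨by rintro _ rfl; exact h, fun f hf => ?_⟩
    obtain rfl : f = star circleCoord := by
      rw [← star_star f]
      exact congrArg star hf
    have h1 : σ (star circleCoord) * σ circleCoord = 1 := by
      rw [← map_mul, mul_comm, hzz, map_one]
    have h2 : τ circleCoord * τ (star circleCoord) = 1 := by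
      rw [← map_mul, hzz, map_one]
    rw [SetLike.mem_coe, hE]
    calc σ (star circleCoord) * S
        = σ (star circleCoord) * (S * τ circleCoord) * τ (star circleCoord) := by
          rw [mul_assoc, mul_assoc S, h2, mul_one]
      _ = S * τ (star circleCoord) := by rw [← h, ← mul_assoc, h1, one_mul]
  have hf : f ∈ (StarAlgebra.adjoin ℂ {circleCoord}).topologicalClosure := by
    rw [circle_topologicalClosure_adjoin_coord]
    trivial
  exact closure_minimal (s := ((StarAlgebra.adjoin ℂ {circleCoord} : StarSubalgebra ℂ C(Circle, ℂ)) :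
    Set C(Circle, ℂ))) hadj hclosed hf

end

noncomputable section

/-! ### Matrix norms -/

section MatrixNorm

variable {B C : Type*} [CStarAlgebra B] [PartialOrder B] [StarOrderedRing B] [CStarAlgebra C]
  [PartialOrder C] [StarOrderedRing C]

theorem CStarMatrix.norm_map_le {n : ℕ} (φ : B →⋆ₙₐ[ℂ] C) (M : Matrix (Fin n) (Fin n) B) :
    ‖CStarMatrix.ofMatrix (M.map φ)‖ ≤ ‖CStarMatrix.ofMatrix M‖ :=
  NonUnitalStarAlgHom.norm_apply_le (CStarMatrix.mapₙₐ (n := Fin n) φ) (CStarMatrix.ofMatrix M)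

theorem CStarMatrix.norm_map_of_injective {n : ℕ} (φ : B →⋆ₙₐ[ℂ] C) (hφ : Function.Injective φ)
    (M : Matrix (Fin n) (Fin n) B) :
    ‖CStarMatrix.ofMatrix (M.map φ)‖ = ‖CStarMatrix.ofMatrix M‖ :=
  NonUnitalStarAlgHom.norm_map (CStarMatrix.mapₙₐ (n := Fin n) φ)
    (CStarMatrix.map_injective hφ) (CStarMatrix.ofMatrix M)

theorem CStarMatrix.norm_one_by_one_le (a : B) :
    ‖CStarMatrix.ofMatrix (Matrix.of fun _ _ : Fin 1 => a)‖ ≤ ‖a‖ := by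
  let φ : B →⋆ₙₐ[ℂ] CStarMatrix (Fin 1) (Fin 1) B :=
    { toFun := fun a => CStarMatrix.ofMatrix (Matrix.of fun _ _ : Fin 1 => a)
      map_smul' := fun _ _ => rfl
      map_zero' := rfl
      map_add' := fun _ _ => rfl
      map_mul' := fun x y => by
        ext i j
        rw [CStarMatrix.mul_apply, Fin.sum_univ_one]
        rfl
      map_star' := fun _ => rfl }
  exact NonUnitalStarAlgHom.norm_apply_le φ a

/-- Compression by a projection does not increase matrix norms. -/
theorem CStarMatrix.norm_compress_le {n : ℕ} {p : B} (hp : IsSelfAdjoint p)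
    (hpp : p * p = p) (M : Matrix (Fin n) (Fin n) B) :
    ‖CStarMatrix.ofMatrix (M.map fun x => p * x * p)‖ ≤ ‖CStarMatrix.ofMatrix M‖ := by
  let Q : CStarMatrix (Fin n) (Fin n) B := CStarMatrix.ofMatrix (Matrix.diagonal fun _ => p)
  have hmul : ∀ M N : Matrix (Fin n) (Fin n) B, CStarMatrix.ofMatrix (M * N)
      = CStarMatrix.ofMatrix M * CStarMatrix.ofMatrix N := fun _ _ => rfl
  have hQ : CStarMatrix.ofMatrix (M.map fun x => p * x * p) = Q * CStarMatrix.ofMatrix M * Q := by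
    rw [← hmul, ← hmul]
    refine congrArg CStarMatrix.ofMatrix (Matrix.ext fun i j => ?_)
    simp
  have hQs : star Q = Q := by
    change (Matrix.conjTranspose (Matrix.diagonal fun _ => p) : Matrix _ _ B) = _
    rw [Matrix.diagonal_conjTranspose]
    exact congrArg Matrix.diagonal (funext fun _ => hp)
  have hQQ : Q * Q = Q := by
    rw [← hmul, Matrix.diagonal_mul_diagonal]
    exact congrArg Matrix.diagonal (funext fun _ => hpp)
  have hQ1 : ‖Q‖ ≤ 1 := by
    have h := CStarRing.norm_star_mul_self (x := Q)
    rw [hQs, hQQ] at h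
    by_contra! h1
    nlinarith
  rw [hQ]
  calc ‖Q * CStarMatrix.ofMatrix M * Q‖ ≤ ‖Q‖ * ‖CStarMatrix.ofMatrix M‖ * ‖Q‖ := by
        refine (norm_mul_le _ _).trans ?_
        gcongr
        exact norm_mul_le _ _
    _ ≤ 1 * ‖CStarMatrix.ofMatrix M‖ * 1 := by gcongr
    _ = ‖CStarMatrix.ofMatrix M‖ := by ring

end MatrixNorm

section Compression

variable {H K : Type u} [NormedAddCommGroup H] [InnerProductSpace ℂ H] [CompleteSpace H]
  [NormedAddCommGroup K] [InnerProductSpace ℂ K] [CompleteSpace K]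

/-- The compression of an operator to an isometrically embedded subspace. -/
def compression (J : H →ₗᵢ[ℂ] K) : (K →L[ℂ] K) →L[ℂ] (H →L[ℂ] H) :=
  LinearMap.mkContinuous
    { toFun := fun x => (ContinuousLinearMap.adjoint J.toContinuousLinearMap) ∘L x ∘L
        J.toContinuousLinearMap
      map_add' := fun x y => by ext; simp
      map_smul' := fun c x => by ext; simp } 1 fun x => by
    have hJ : ‖J.toContinuousLinearMap‖ ≤ 1 := J.norm_toContinuousLinearMap_le
    have hJ' : ‖ContinuousLinearMap.adjoint J.toContinuousLinearMap‖ ≤ 1 := by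
      rwa [LinearIsometryEquiv.norm_map]
    rw [one_mul]
    refine (ContinuousLinearMap.opNorm_comp_le _ _).trans ?_
    have h2 := ContinuousLinearMap.opNorm_comp_le x J.toContinuousLinearMap
    nlinarith [norm_nonneg x, norm_nonneg (x ∘L J.toContinuousLinearMap),
      norm_nonneg (ContinuousLinearMap.adjoint J.toContinuousLinearMap)]

theorem norm_compression_le (J : H →ₗᵢ[ℂ] K) (x : K →L[ℂ] K) : ‖compression J x‖ ≤ ‖x‖ := by
  simpa using (compression J).le_of_opNorm_le (LinearMap.mkContinuous_norm_le _ zero_le_one _) x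

theorem adjoint_comp_self_apply (J : H →ₗᵢ[ℂ] K) (x : H) :
    ContinuousLinearMap.adjoint J.toContinuousLinearMap (J x) = x :=
  DFunLike.congr_fun ((ContinuousLinearMap.norm_map_iff_adjoint_comp_self
    J.toContinuousLinearMap).mp J.norm_map) x

/-- The operators on an isometrically embedded subspace, as operators on the large space. -/
def corner (J : H →ₗᵢ[ℂ] K) : (H →L[ℂ] H) →⋆ₙₐ[ℂ] (K →L[ℂ] K) where
  toFun y := J.toContinuousLinearMap ∘L y ∘L
    (ContinuousLinearMap.adjoint J.toContinuousLinearMap)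
  map_smul' c y := by ext; simp
  map_zero' := by ext; simp
  map_add' y z := by ext; simp
  map_mul' y z := by
    ext k
    simp [adjoint_comp_self_apply]
  map_star' y := by
    simp only [ContinuousLinearMap.star_eq_adjoint, ContinuousLinearMap.adjoint_comp,
      ContinuousLinearMap.adjoint_adjoint]
    rfl

theorem corner_apply_apply (J : H →ₗᵢ[ℂ] K) (y : H →L[ℂ] H) (k : K) :
    corner J y k = J (y (ContinuousLinearMap.adjoint J.toContinuousLinearMap k)) := rfl

theorem corner_injective (J : H →ₗᵢ[ℂ] K) : Function.Injective (corner J) := fun y z h => by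
  ext x
  have := DFunLike.congr_fun h (J x)
  rw [corner_apply_apply, corner_apply_apply, adjoint_comp_self_apply] at this
  exact J.injective this

/-- The embedding `corner J` is an injective star homomorphism, hence isometric on matrices. It
carries the compression of `x` to `p x p` with `p = J J*`, so the comparison takes place inside
matrices over one C⋆-algebra. -/
theorem opNormMatrix_compression_le {n : ℕ} (J : H →ₗᵢ[ℂ] K)
    (M : Matrix (Fin n) (Fin n) (K →L[ℂ] K)) :
    opNormMatrix (M.map (compression J)) ≤ opNormMatrix M := by
  have hp : IsSelfAdjoint (corner J 1) := by
    rw [IsSelfAdjoint, ← map_star, star_one]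
  have hpp : corner J 1 * corner J 1 = corner J 1 := by
    rw [← map_mul, one_mul]
  have h : (M.map (compression J)).map (corner J)
      = M.map fun x => corner J 1 * x * corner J 1 := by
    ext i j k
    rfl
  rw [opNormMatrix, ← CStarMatrix.norm_map_of_injective (corner J) (corner_injective J), h]
  exact CStarMatrix.norm_compress_le hp hpp M

end Compression

/-! ### Functoriality of the semicrossed product -/

section Functoriality

variable {B : Type u} [CStarAlgebra B] [PartialOrder B] [StarOrderedRing B] {A : Subalgebra ℂ B}
  {α : A →ₐ[ℂ] A}

theorem CovariantRep.norm_ρ_le (π : CovariantRep α) (a : A) : ‖π.ρ a‖ ≤ ‖a‖ := by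
  have h1 := π.completelyContractive 1 (Matrix.of fun _ _ : Fin 1 => a)
  have h2 : ‖π.ρ a‖ ≤ opNormMatrix ((Matrix.of fun _ _ : Fin 1 => a).map π.ρ) :=
    CStarMatrix.norm_entry_le_norm (i := 0) (j := 0)
      (M := CStarMatrix.ofMatrix ((Matrix.of fun _ _ : Fin 1 => a).map π.ρ))
  exact (h2.trans h1).trans (CStarMatrix.norm_one_by_one_le (a : B))

theorem CovariantRep.continuous_ρ (π : CovariantRep α) : Continuous π.ρ :=
  AddMonoidHomClass.continuous_of_bound π.ρ 1 fun a => by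
    rw [one_mul]
    exact π.norm_ρ_le a

variable {B' : Type u} [CStarAlgebra B'] [PartialOrder B'] [StarOrderedRing B']
  {A' : Subalgebra ℂ B'} {β : A' →ₐ[ℂ] A'}

namespace CovariantPoly

/-- The homomorphism of polynomial algebras given by an equivariant homomorphism of
coefficients. -/
def map (r : A →ₐ[ℂ] A') (hr : ∀ a, r (α a) = β (r a)) :
    CovariantPoly α →ₐ[ℂ] CovariantPoly β :=
  AlgHom.ofLinearMap (lift fun i => monomial β i ∘ₗ r.toLinearMap)
    (by simp [one_def])
    (fun p q => by
      have key : ∀ (j : ℕ) (a : A), r ((α ^ j) a) = (β ^ j) (r a) := by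
        intro j
        induction j with
        | zero => intro a; rfl
        | succ j ih =>
          intro a
          rw [pow_succ, pow_succ]
          change r ((α ^ j) (α a)) = (β ^ j) (β (r a))
          rw [ih, hr]
      induction p using induction_poly with
      | h0 => simp
      | hadd p p' hp hp' => simp only [add_mul, map_add, hp, hp']
      | hm i a =>
        induction q using induction_poly with
        | h0 => simp
        | hadd q q' hq hq' => simp only [mul_add, map_add, hq, hq']
        | hm j c =>
          rw [monomial_mul_monomial]
          simp only [lift_monomial, LinearMap.comp_apply, AlgHom.toLinearMap_apply, map_mul]
          rw [monomial_mul_monomial, key])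

variable {r : A →ₐ[ℂ] A'} {hr : ∀ a, r (α a) = β (r a)}

@[simp] theorem map_monomial (i : ℕ) (a : A) :
    map r hr (monomial α i a) = monomial β i (r a) := by
  simp [map]

/-- The homomorphism of polynomial algebras is isometric if the representations of either side are
dominated by representations of the other. -/
theorem norm_map
    (h₁ : ∀ π : CovariantRep β, ∃ π' : CovariantRep α, ∀ p, ‖eval π (map r hr p)‖ ≤ ‖eval π' p‖)
    (h₂ : ∀ π : CovariantRep α, ∃ π' : CovariantRep β, ∀ p, ‖eval π p‖ ≤ ‖eval π' (map r hr p)‖)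
    (p : CovariantPoly α) : ‖map r hr p‖ = ‖p‖ := by
  refine le_antisymm (Real.iSup_le (fun π => ?_) (norm_nonneg _))
    (Real.iSup_le (fun π => ?_) (norm_nonneg _))
  · obtain ⟨π', h⟩ := h₁ π
    exact (h p).trans (norm_eval_le π' p)
  · obtain ⟨π', h⟩ := h₂ π
    exact (h p).trans (norm_eval_le π' _)

end CovariantPoly

namespace SemicrossedProduct

/-- The extension to semicrossed products of a contractive homomorphism of polynomial algebras. -/
def map (Ψ : CovariantPoly α →ₐ[ℂ] CovariantPoly β) (hΨ : Continuous Ψ) :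
    SemicrossedProduct α →ₐ[ℂ] SemicrossedProduct β where
  __ := (UniformSpace.Completion.mapRingHom Ψ.toRingHom hΨ :
    UniformSpace.Completion (CovariantPoly α) →+* UniformSpace.Completion (CovariantPoly β))
  commutes' c := by
    have h : ∀ p, UniformSpace.Completion.mapRingHom Ψ.toRingHom hΨ (ofPoly α p)
        = ofPoly β (Ψ p) := fun p => UniformSpace.Completion.mapRingHom_coe hΨ p
    have h1 := h (algebraMap ℂ _ c)
    rw [AlgHom.commutes, AlgHom.commutes, AlgHom.commutes] at h1
    exact h1

variable {Ψ : CovariantPoly α →ₐ[ℂ] CovariantPoly β} {hΨ : Continuous Ψ}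

theorem map_ofPoly (p : CovariantPoly α) : map Ψ hΨ (ofPoly α p) = ofPoly β (Ψ p) :=
  UniformSpace.Completion.mapRingHom_coe hΨ p

theorem continuous_map : Continuous (map Ψ hΨ) :=
  UniformSpace.Completion.continuous_map

theorem isometry_map (h : ∀ p, ‖Ψ p‖ = ‖p‖) : Isometry (map Ψ hΨ) := by
  refine AddMonoidHomClass.isometry_of_norm _ fun x => ?_
  have hc := continuous_map (Ψ := Ψ) (hΨ := hΨ)
  induction x using denseRange_ofPoly.induction_on with
  | hp => exact isClosed_eq (by fun_prop) (by fun_prop)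
  | ih p => rw [map_ofPoly, norm_ofPoly, norm_ofPoly, h]

theorem matrixNorm_nonneg {n : ℕ} (M : Matrix (Fin n) (Fin n) (SemicrossedProduct α)) :
    0 ≤ matrixNorm M :=
  Real.iSup_nonneg fun _ => norm_nonneg _

theorem opNormMatrix_le_matrixNorm {n : ℕ} (M : Matrix (Fin n) (Fin n) (SemicrossedProduct α))
    (π : CovariantRep α) : opNormMatrix (M.map (integrated π)) ≤ matrixNorm M :=
  le_ciSup (bddAbove_opNormMatrix M) π

end SemicrossedProduct

end Functoriality

end

noncomputable section

/-! ### Restriction from the disc to the circle -/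

theorem restrictToCircle_endo (b : FiniteBlaschke) (f : diskAlgebra) :
    restrictToCircle (diskEndo b f) = circleEndo b (restrictToCircle f) := rfl

/-- Restriction to the circle is the trace on the disc algebra of a star homomorphism between the
ambient C⋆-algebras. The maximum principle is not required. -/
theorem opMatrixNorm_restrictToCircle_le (n : ℕ) (M : Matrix (Fin n) (Fin n) diskAlgebra) :
    opMatrixNorm circleAlgebra (M.map restrictToCircle) ≤ opMatrixNorm diskAlgebra M :=
  CStarMatrix.norm_map_le
    (ContinuousMap.compStarAlgHom' ℂ ℂ circleToDisk).toNonUnitalStarAlgHom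
    (M.map fun a => (a : C(Metric.closedBall (0 : ℂ) 1, ℂ)))

/-- A covariant representation of the circle system restricts to one of the disc system. -/
def CovariantRep.restrictToDisk {b : FiniteBlaschke} (π : CovariantRep (circleEndo b)) :
    CovariantRep (diskEndo b) where
  H := π.H
  ρ := π.ρ.comp restrictToCircle
  completelyContractive n M :=
    (π.completelyContractive n (M.map restrictToCircle)).trans
      (opMatrixNorm_restrictToCircle_le n M)
  T := π.T
  norm_T_le := π.norm_T_le
  covariant a := π.covariant (restrictToCircle a)

/-- Restriction of the coefficients to the circle. -/
def restrictPoly (b : FiniteBlaschke) :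
    CovariantPoly (diskEndo b) →ₐ[ℂ] CovariantPoly (circleEndo b) :=
  CovariantPoly.map restrictToCircle (restrictToCircle_endo b)

theorem CovariantPoly.eval_restrictToDisk {b : FiniteBlaschke} (π : CovariantRep (circleEndo b))
    (p : CovariantPoly (diskEndo b)) :
    CovariantPoly.eval π (restrictPoly b p) = CovariantPoly.eval π.restrictToDisk p := by
  induction p using CovariantPoly.induction_poly with
  | h0 =>
    rw [map_zero, map_zero, map_zero]
    rfl
  | hadd p q hp hq =>
    rw [map_add, map_add, map_add, hp, hq]
    rfl
  | hm i a =>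
    rw [restrictPoly, CovariantPoly.map_monomial, CovariantPoly.eval_monomial,
      CovariantPoly.eval_monomial]
    rfl

/-- Every covariant representation of the disc system dilates to one of the circle system. -/
theorem CovariantRep.exists_circle_dilation {b : FiniteBlaschke} (π : CovariantRep (diskEndo b)) :
    ∃ (π' : CovariantRep (circleEndo b)) (J : π.H →ₗᵢ[ℂ] π'.H), ∀ (n : ℕ) (f : diskAlgebra),
      compression J (π'.T ^ n * π'.ρ (restrictToCircle f)) = π.T ^ n * π.ρ f := by
  have hA : ‖π.ρ diskCoord‖ ≤ 1 := by
    refine (π.norm_ρ_le diskCoord).trans ((ContinuousMap.norm_le _ zero_le_one).mpr fun z => ?_)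
    exact mem_closedBall_zero_iff.mp z.2
  obtain ⟨K, i1, i2, i3, J, U, S, hU, hS, hUS, hdil⟩ := b.exists_unitary_dilation hA π.norm_T_le
    (by rw [← map_diskEndo_coord]; exact π.covariant diskCoord)
  obtain ⟨σ, hσ⟩ := exists_circle_calculus hU
  let ρ' : circleAlgebra →ₐ[ℂ] (K →L[ℂ] K) := σ.toAlgHom.comp circleAlgebra.val
  have hρ' : ρ' (restrictToCircle diskCoord) = U := hσ
  -- The representation `σ` restricted to the disc algebra sends the coordinate to `U`, so the
  -- formula for `α(z)` there computes its value at `b`.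
  have hσb : σ (circleCoord.comp b.circleMap) = b.evalOp U := by
    rw [← hρ']
    exact map_diskEndo_coord b (ρ'.comp restrictToCircle)
  let π' : CovariantRep (circleEndo b) :=
    { H := K
      ρ := ρ'
      completelyContractive := fun n M => CStarMatrix.norm_map_le σ.toNonUnitalStarAlgHom
        (M.map fun a => (a : C(Circle, ℂ)))
      T := S
      norm_T_le := hS
      covariant := fun f => circle_covariant
        (τ := σ.comp (ContinuousMap.compStarAlgHom' ℂ ℂ b.circleMap)) (by
          change σ circleCoord * S = S * σ (circleCoord.comp b.circleMap)
          rw [hσ, hσb, hUS]) f.1 }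
  refine ⟨π', J, fun n => ?_⟩
  have hr : Continuous restrictToCircle :=
    Continuous.subtype_mk ((ContinuousMap.continuous_precomp circleToDisk).comp
      continuous_subtype_val) _
  -- Both sides are continuous and linear in `f`, so density of polynomials reduces the claim to
  -- powers of the coordinate, where it is the dilation identity.
  let F : diskAlgebra →ₗ[ℂ] (π.H →L[ℂ] π.H) := (compression J).toLinearMap ∘ₗ
    LinearMap.mulLeft ℂ (π'.T ^ n) ∘ₗ π'.ρ.toLinearMap ∘ₗ restrictToCircle.toLinearMap
  let G : diskAlgebra →ₗ[ℂ] (π.H →L[ℂ] π.H) := LinearMap.mulLeft ℂ (π.T ^ n) ∘ₗ π.ρ.toLinearMap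
  have hF : Continuous F := (compression J).continuous.comp
    (continuous_const.mul (π'.continuous_ρ.comp hr))
  have hG : Continuous G := continuous_const.mul π.continuous_ρ
  refine fun f => DFunLike.congr_fun (diskAlgebra_linearMap_ext hF hG fun m => ?_) f
  change compression J (S ^ n * ρ' (restrictToCircle (diskCoord ^ m)))
    = π.T ^ n * π.ρ (diskCoord ^ m)
  rw [map_pow, map_pow, map_pow, hρ']
  exact hdil m n

theorem CovariantPoly.compression_eval_restrictPoly {b : FiniteBlaschke}
    {π : CovariantRep (diskEndo b)} {π' : CovariantRep (circleEndo b)} {J : π.H →ₗᵢ[ℂ] π'.H}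
    (h : ∀ (n : ℕ) (f : diskAlgebra),
      compression J (π'.T ^ n * π'.ρ (restrictToCircle f)) = π.T ^ n * π.ρ f)
    (p : CovariantPoly (diskEndo b)) :
    compression J (CovariantPoly.eval π' (restrictPoly b p)) = CovariantPoly.eval π p := by
  induction p using CovariantPoly.induction_poly with
  | h0 => simp
  | hadd p q hp hq => rw [map_add, map_add, map_add, map_add, hp, hq]
  | hm i a =>
    rw [restrictPoly, CovariantPoly.map_monomial, CovariantPoly.eval_monomial,
      CovariantPoly.eval_monomial, h]

theorem CovariantPoly.norm_restrictPoly {b : FiniteBlaschke} (p : CovariantPoly (diskEndo b)) :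
    ‖restrictPoly b p‖ = ‖p‖ := by
  refine CovariantPoly.norm_map (fun π => ⟨π.restrictToDisk, fun p => ?_⟩) (fun π => ?_) p
  · exact (congrArg norm (CovariantPoly.eval_restrictToDisk π p)).le
  · obtain ⟨π', J, h⟩ := π.exists_circle_dilation
    refine ⟨π', fun p => ?_⟩
    rw [← CovariantPoly.compression_eval_restrictPoly h]
    exact norm_compression_le J _

namespace SemicrossedProduct

variable {b : FiniteBlaschke} {hc : Continuous (restrictPoly b)}

theorem integrated_map_restrictPoly (π : CovariantRep (circleEndo b))
    (x : SemicrossedProduct (diskEndo b)) :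
    integrated π (map (restrictPoly b) hc x) = integrated π.restrictToDisk x := by
  have h1 := continuous_map (hΨ := hc)
  have h2 := continuous_integrated π
  have h3 := continuous_integrated π.restrictToDisk
  induction x using denseRange_ofPoly.induction_on with
  | hp => exact isClosed_eq (h2.comp h1) h3
  | ih p =>
    rw [map_ofPoly, integrated_ofPoly, integrated_ofPoly, CovariantPoly.eval_restrictToDisk]

theorem compression_integrated_map_restrictPoly
    {π : CovariantRep (diskEndo b)} {π' : CovariantRep (circleEndo b)} {J : π.H →ₗᵢ[ℂ] π'.H}
    (h : ∀ (n : ℕ) (f : diskAlgebra),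
      compression J (π'.T ^ n * π'.ρ (restrictToCircle f)) = π.T ^ n * π.ρ f)
    (x : SemicrossedProduct (diskEndo b)) :
    compression J (integrated π' (map (restrictPoly b) hc x)) = integrated π x := by
  have h1 := continuous_map (hΨ := hc)
  have h2 := continuous_integrated π'
  have h3 := continuous_integrated π
  induction x using denseRange_ofPoly.induction_on with
  | hp => exact isClosed_eq ((compression J).continuous.comp (h2.comp h1)) h3
  | ih p =>
    rw [map_ofPoly, integrated_ofPoly, integrated_ofPoly,
      CovariantPoly.compression_eval_restrictPoly h]

/-- Restricting a circle representation gives `≤`; dilating a disc representation and compressing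
back gives `≥`, since compression does not increase matrix norms. -/
theorem matrixNorm_map_restrictPoly {n : ℕ}
    (M : Matrix (Fin n) (Fin n) (SemicrossedProduct (diskEndo b))) :
    matrixNorm (M.map (map (restrictPoly b) hc)) = matrixNorm M := by
  refine le_antisymm (Real.iSup_le (fun π => ?_) (matrixNorm_nonneg _))
    (Real.iSup_le (fun π => ?_) (matrixNorm_nonneg _))
  · have h : (M.map (map (restrictPoly b) hc)).map (integrated π)
        = M.map (integrated π.restrictToDisk) :=
      Matrix.ext fun i j => integrated_map_restrictPoly (hc := hc) π (M i j)
    rw [h]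
    exact opNormMatrix_le_matrixNorm M π.restrictToDisk
  · obtain ⟨π', J, hJ⟩ := π.exists_circle_dilation
    have h : M.map (integrated π)
        = ((M.map (map (restrictPoly b) hc)).map (integrated π')).map (compression J) :=
      Matrix.ext fun i j => (compression_integrated_map_restrictPoly (hc := hc) hJ (M i j)).symm
    rw [h]
    exact (opNormMatrix_compression_le J _).trans (opNormMatrix_le_matrixNorm _ π')

end SemicrossedProduct

/-- The semicrossed product of the disc algebra embeds completely isometrically in that of the
continuous functions on the circle. -/
theorem diskSemicrossedProduct_embeds (b : FiniteBlaschke) :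
    ∃ Φ : SemicrossedProduct (diskEndo b) →ₐ[ℂ] SemicrossedProduct (circleEndo b),
      (∀ f : diskAlgebra, Φ (SemicrossedProduct.coeff (diskEndo b) f) =
        SemicrossedProduct.coeff (circleEndo b) (restrictToCircle f)) ∧
      Φ (SemicrossedProduct.gen (diskEndo b)) = SemicrossedProduct.gen (circleEndo b) ∧
      Isometry Φ ∧
      ∀ (n : ℕ) (M : Matrix (Fin n) (Fin n) (SemicrossedProduct (diskEndo b))),
        SemicrossedProduct.matrixNorm (M.map Φ) = SemicrossedProduct.matrixNorm M := by
  have hc : Continuous (restrictPoly b) :=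
    (AddMonoidHomClass.isometry_of_norm (restrictPoly b)
      CovariantPoly.norm_restrictPoly).continuous
  refine ⟨SemicrossedProduct.map (restrictPoly b) hc, fun f => ?_, ?_,
    SemicrossedProduct.isometry_map CovariantPoly.norm_restrictPoly,
    fun n M => SemicrossedProduct.matrixNorm_map_restrictPoly M⟩
  · rw [SemicrossedProduct.coeff, SemicrossedProduct.map_ofPoly, restrictPoly,
      CovariantPoly.map_monomial]
    rfl
  · rw [SemicrossedProduct.gen, SemicrossedProduct.map_ofPoly, restrictPoly,
      CovariantPoly.map_monomial, map_one]
    rfl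

end

theorem theorem2p1 (b : FiniteBlaschke) :
    (∃ Φ : SemicrossedProduct (diskEndo b) →ₐ[ℂ] SemicrossedProduct (circleEndo b),
      (∀ f : diskAlgebra, Φ (SemicrossedProduct.coeff (diskEndo b) f) =
        SemicrossedProduct.coeff (circleEndo b) (restrictToCircle f)) ∧
      Φ (SemicrossedProduct.gen (diskEndo b)) = SemicrossedProduct.gen (circleEndo b) ∧
      Isometry Φ ∧
      ∀ (n : ℕ) (M : Matrix (Fin n) (Fin n) (SemicrossedProduct (diskEndo b))),
        SemicrossedProduct.matrixNorm (M.map Φ) = SemicrossedProduct.matrixNorm M) ∧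
    (∀ (H : Type u) [NormedAddCommGroup H] [InnerProductSpace ℂ H] [CompleteSpace H]
      (A T : H →L[ℂ] H), ‖A‖ ≤ 1 → ‖T‖ ≤ 1 → A * T = T * b.evalOp A →
      ∃ (K : Type u) (_ : NormedAddCommGroup K) (_ : InnerProductSpace ℂ K)
        (_ : CompleteSpace K) (J : H →ₗᵢ[ℂ] K) (U S : K →L[ℂ] K),
        U ∈ unitary (K →L[ℂ] K) ∧ ‖S‖ ≤ 1 ∧ U * S = S * b.evalOp U ∧
        ∀ m n : ℕ,
          (ContinuousLinearMap.adjoint J.toContinuousLinearMap) ∘L (S ^ n * U ^ m) ∘L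
            J.toContinuousLinearMap = T ^ n * A ^ m) := by
  exact ⟨diskSemicrossedProduct_embeds b, fun H _ _ _ A T hA hT hAT =>
    b.exists_unitary_dilation hA hT hAT⟩
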